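/- Conventions. All groupoids are small; for a groupoid $\mathcal G$ with base (set of objects) $\mathcal P$ the composite of $f$ followed by $g$ is written $fg$. A left action of $\mathcal G$ on a map $p:\mathcal E\to\mathcal P$ assigns to $g\in\mathcal G$ and $e\in\mathcal E$ with $p(e)$ the end of $g$ an element $g\triangleright e$ such that $p(g\triangleright e)$ is the source of $g$, $g\triangleright(h\triangleright e)=gh\triangleright e$ and identities act trivially; right actions are defined symmetrically. A matched pair of groupoids $(\mathcal V,\mathcal H)$ consists of two groupoids with the same base $\mathcal P$, where $t,b:\mathcal V\to\mathcal P$ and $l,r:\mathcal H\to\mathcal P$ denote the source and end maps, a left action $x\triangleright g$ of $\mathcal H$ on $t:\mathcal V\to\mathcal P$ and a right action $x\triangleleft g$ of $\mathcal V$ on $r:\mathcal H\to\mathcal P$ (both defined when $r(x)=t(g)$) such that $b(x\triangleright g)=l(x\triangleleft g)$, $x\triangleright fg=(x\triangleright f)((x\triangleleft f)\triangleright g)$ and $xy\triangleleft g=(x\triangleleft(y\triangleright g))(y\triangleleft g)$. A quiver over $\mathcal P$ is a set $\mathcal E$ with two maps $p,q:\mathcal E\to\mathcal P$; these form a category $\mathrm{Quiv}(\mathcal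 P)$. A representation of $(\mathcal V,\mathcal H)$ is a quiver $(\mathcal E,p,q)$ over $\mathcal P$ with a left action of $\mathcal H$ on $p$ and a degree map $|\cdot|:\mathcal E\to\mathcal V$ such that $p(e)=t(|e|)$, $q(e)=b(|e|)$ and $|x\triangleright e|=x\triangleright|e|$. Morphisms are maps preserving action and degree. The category $\mathrm{Rep}(\mathcal V,\mathcal H)$ of representations is monoidal, with $\mathcal E\otimes\mathcal F=\{(e,f):q(e)=p(f)\}$, $p(e,f)=p(e)$, $q(e,f)=q(f)$, $x\triangleright(e,f)=(x\triangleright e,(x\triangleleft|e|)\triangleright f)$, $|(e,f)|=|e||f|$, and unit object $\mathcal P$ (with $p=q=\mathrm{id}$, $x\triangleright r(x)=l(x)$, and $|P|$ the identity of $\mathcal V$ at $P$). Let $f\ell:\mathrm{Rep}(\mathcal V,\mathcal H)\to\mathrm{Quiv}(\mathcal P)$ be the forgetful functor. The double $D(\mathcal V,\mathcal H)$ is the following matched pair with base $\mathcal P$. Its vertical groupoid is the restricted product of $\mathcal V$ and $\mathcal H^{op}$: the pairs $(\gamma,x)\in\mathcal V\times\mathcal H$ with $t(\gamma)=r(x)$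 and $b(\gamma)=l(x)$, with $(\gamma,x)(\gamma',x')=(\gamma\gamma',x'x)$. Its horizontal groupoid is the diagonal groupoid $\mathcal V\bowtie\mathcal H$: the pairs $(g,h)\in\mathcal V\times\mathcal H$ with $b(g)=l(h)$, with source $t(g)$, end $r(h)$ and $(f,y)(h,z)=(f(y\triangleright h),(y\triangleleft h)z)$. Its actions are $$(g,h)\rightharpoonup(\gamma,x)=\bigl(g(h\triangleright\gamma)(\Omega\triangleright g^{-1}),\ \Omega\triangleleft g^{-1}\bigr),\qquad (g,h)\leftharpoonup(\gamma,x)=\bigl((\Omega\triangleleft g^{-1})\triangleright g,\ h\triangleleft\gamma\bigr),\qquad \Omega=(h\triangleleft\gamma)\,x\,h^{-1}.$$ Corollary. Let $(\mathcal V,\mathcal H)$ be a matched pair of groupoids with base $\mathcal P$. There is a strict monoidal equivalence $$\mathrm{Rep}\,D(\mathcal V,\mathcal H)\;\cong\;Z\bigl(\mathrm{Rep}(\mathcal V,\mathcal H)\bigr)$$ between the category of representations of the double and the (Drinfeld) center of the monoidal category of representations: a monoidal equivalence in which both functors are strict monoidal. Moreover, it is compatible with the forgetful functors: if $U:Z(\mathrm{Rep}(\mathcal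 V,\mathcal H))\to\mathrm{Rep}(\mathcal V,\mathcal H)$ denotes the functor that forgets the half-braiding, then the composite $\mathrm{Rep}\,D(\mathcal V,\mathcal H)\cong Z(\mathrm{Rep}(\mathcal V,\mathcal H))\xrightarrow{U}\mathrm{Rep}(\mathcal V,\mathcal H)\xrightarrow{f\ell}\mathrm{Quiv}(\mathcal P)$ equals the forgetful functor $f\ell:\mathrm{Rep}\,D(\mathcal V,\mathcal H)\to\mathrm{Quiv}(\mathcal P)$. -/

import Mathlib

open CategoryTheory MonoidalCategory

universe u

/-- A (small) groupoid with base `P`, presented by its set of arrows: source and end maps,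
identities, inverses, and a composition `comp f g` (in diagrammatic order, so `f` comes first)
defined for the pairs of arrows such that the end of `f` is the source of `g`. -/
structure GroupoidOver (P : Type u) where
  Arr : Type u
  src : Arr → P
  tgt : Arr → P
  one : P → Arr
  inv : Arr → Arr
  comp : (f g : Arr) → tgt f = src g → Arr
  src_one : ∀ a, src (one a) = a
  tgt_one : ∀ a, tgt (one a) = a
  src_inv : ∀ f, src (inv f) = tgt f
  tgt_inv : ∀ f, tgt (inv f) = src f
  src_comp : ∀ f g h, src (comp f g h) = src f
  tgt_comp : ∀ f g h, tgt (comp f g h) = tgt g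
  one_comp : ∀ f, comp (one (src f)) f (tgt_one _) = f
  comp_one : ∀ f, comp f (one (tgt f)) (src_one _).symm = f
  comp_assoc : ∀ f g k (h : tgt f = src g) (h' : tgt g = src k),
    comp (comp f g h) k ((tgt_comp f g h).trans h') =
      comp f (comp g k h') (h.trans (src_comp g k h').symm)
  inv_comp : ∀ f, comp (inv f) f (tgt_inv f) = one (tgt f)
  comp_inv : ∀ f, comp f (inv f) (src_inv f).symm = one (src f)

attribute [simp] GroupoidOver.src_one GroupoidOver.tgt_one GroupoidOver.src_inv
  GroupoidOver.tgt_inv GroupoidOver.src_comp GroupoidOver.tgt_comp GroupoidOver.one_comp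
  GroupoidOver.comp_one GroupoidOver.inv_comp GroupoidOver.comp_inv

namespace GroupoidOver

variable {P : Type u}

/-- The opposite groupoid. -/
def op (G : GroupoidOver P) : GroupoidOver P where
  Arr := G.Arr
  src := G.tgt
  tgt := G.src
  one := G.one
  inv := G.inv
  comp f g h := G.comp g f h.symm
  src_one := G.tgt_one
  tgt_one := G.src_one
  src_inv := G.tgt_inv
  tgt_inv := G.src_inv
  src_comp _ _ _ := G.tgt_comp _ _ _
  tgt_comp _ _ _ := G.src_comp _ _ _
  one_comp := G.comp_one
  comp_one := G.one_comp
  comp_assoc f g k h h' := (G.comp_assoc k g f h'.symm h.symm).symm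
  inv_comp := G.comp_inv
  comp_inv := G.inv_comp

/-- A pair of parallel arrows, one in each of two groupoids over `P`. -/
@[ext]
structure ProdArr (G K : GroupoidOver P) where
  fst : G.Arr
  snd : K.Arr
  src_eq : G.src fst = K.src snd
  tgt_eq : G.tgt fst = K.tgt snd

/-- The restricted product of two groupoids over `P`: pairs of parallel arrows, with
componentwise operations. -/
def restrictedProd (G K : GroupoidOver P) : GroupoidOver P where
  Arr := ProdArr G K
  src a := G.src a.fst
  tgt a := G.tgt a.fst
  one a := ⟨G.one a, K.one a, by simp, by simp⟩
  inv a := ⟨G.inv a.fst, K.inv a.snd, by simp [a.tgt_eq], by simp [a.src_eq]⟩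
  comp a b h := ⟨G.comp a.fst b.fst h, K.comp a.snd b.snd (by rw [← a.tgt_eq, ← b.src_eq, h]),
    by simp [a.src_eq], by simp [b.tgt_eq]⟩
  src_one a := by simp
  tgt_one a := by simp
  src_inv a := by simp
  tgt_inv a := by simp
  src_comp a b h := by simp
  tgt_comp a b h := by simp
  one_comp a := by
    ext
    · simp
    · simp [a.src_eq]
  comp_one a := by
    ext
    · simp
    · simp [a.tgt_eq]
  comp_assoc a b c h h' := by ext <;> apply comp_assoc
  inv_comp a := by ext <;> simp [a.tgt_eq]
  comp_inv a := by ext <;> simp [a.src_eq]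

variable (G : GroupoidOver P)

theorem inv_comp_cancel (f g : G.Arr) (h : G.tgt f = G.src g) :
    G.comp (G.inv f) (G.comp f g h) (by simp) = g := by
  rw [← G.comp_assoc _ _ _ (by simp) h]; simp [h]

theorem comp_inv_cancel (f g : G.Arr) (h : G.src f = G.src g) :
    G.comp f (G.comp (G.inv f) g (by simpa using h)) (by simp) = g := by
  rw [← G.comp_assoc _ _ _ (by simp) (by simpa using h)]; simp [h]

theorem comp_left_cancel {f g k : G.Arr} (h : G.tgt f = G.src g) (h' : G.tgt f = G.src k)
    (e : G.comp f g h = G.comp f k h') : g = k := by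
  rw [← G.inv_comp_cancel f g h, ← G.inv_comp_cancel f k h']; simp only [e]

theorem comp_congr {f f' g g' : G.Arr} (e : f = f') (e' : g = g') (h : G.tgt f = G.src g)
    (h' : G.tgt f' = G.src g') : G.comp f g h = G.comp f' g' h' := by
  subst e e'; rfl

theorem comp_assoc' (f g k : G.Arr) (h : G.tgt f = G.src g)
    (h' : G.tgt (G.comp f g h) = G.src k) :
    G.comp (G.comp f g h) k h' = G.comp f (G.comp g k (by simpa using h')) (by simp [h]) :=
  G.comp_assoc f g k h (by simpa using h')

theorem eq_inv_of_comp_eq_one {f g : G.Arr} (h : G.tgt f = G.src g)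
    (e : G.comp f g h = G.one (G.src f)) : g = G.inv f := by
  apply G.comp_left_cancel h (by simp); simp [e]

theorem inv_one (a : P) : G.inv (G.one a) = G.one a := by
  refine (G.eq_inv_of_comp_eq_one (by simp) ?_).symm
  have := G.one_comp (G.one a)
  simp only [src_one] at this
  simp [this]

theorem inv_comp_rev (f g : G.Arr) (h : G.tgt f = G.src g) :
    G.inv (G.comp f g h) = G.comp (G.inv g) (G.inv f) (by simp [h]) := by
  refine (G.eq_inv_of_comp_eq_one (by simp) ?_).symm
  simp only [G.comp_assoc f g (G.comp (G.inv g) (G.inv f) (by simp [h])) h (by simp),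
    G.comp_inv_cancel g (G.inv f) (by simp [h])]
  simp

theorem conj_of_eq {a u w : G.Arr} {huw : G.tgt u = G.src w} (e : a = G.comp u w huw)
    (x y : G.Arr) (h : G.tgt a = G.src x) (hxy : G.tgt x = G.src y) (hy : G.tgt y = G.tgt a)
    (hw : G.tgt w = G.src x) (hw' : G.tgt y = G.tgt w) :
    G.comp a (G.comp x (G.comp y (G.inv a) (by simp [hy])) (by simp [hxy])) (by simp [h]) =
      G.comp u (G.comp w (G.comp x (G.comp y (G.comp (G.inv w) (G.inv u) (by simp [huw]))
        (by simp [hw'])) (by simp [hxy])) (by simp [hw])) (by simp [huw]) := by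
  subst e
  simp only [G.inv_comp_rev, G.comp_assoc']

end GroupoidOver

/-- A left action of a groupoid `G` with base `P` on a map `p : E → P`. -/
@[ext]
structure LeftAction {P : Type u} (G : GroupoidOver P) {E : Type u} (p : E → P) where
  act : (g : G.Arr) → (e : E) → G.tgt g = p e → E
  p_act : ∀ g e h, p (act g e h) = G.src g
  act_act : ∀ g k e (h : G.tgt g = G.src k) (h' : G.tgt k = p e),
    act g (act k e h') (h.trans (p_act k e h').symm) =
      act (G.comp g k h) e ((G.tgt_comp g k h).trans h')
  one_act : ∀ e, act (G.one (p e)) e (G.tgt_one _) = e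

/-- A right action of a groupoid `G` with base `P` on a map `q : E → P`. -/
@[ext]
structure RightAction {P : Type u} (G : GroupoidOver P) {E : Type u} (q : E → P) where
  act : (e : E) → (g : G.Arr) → q e = G.src g → E
  q_act : ∀ e g h, q (act e g h) = G.tgt g
  act_act : ∀ e g k (h : q e = G.src g) (h' : G.tgt g = G.src k),
    act (act e g h) k ((q_act e g h).trans h') =
      act e (G.comp g k h') (h.trans (G.src_comp g k h').symm)
  act_one : ∀ e, act e (G.one (q e)) (G.src_one _).symm = e

/-- A matched pair of groupoids `(V, H)` with base `P`: a left action `x ▷ g` of `H` on the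
source (top) map of `V` and a right action `x ◁ g` of `V` on the end (right) map of `H`, both
defined when `r(x) = t(g)`, such that `b(x ▷ g) = l(x ◁ g)`,
`x ▷ fg = (x ▷ f)((x ◁ f) ▷ g)` and `xy ◁ g = (x ◁ (y ▷ g))(y ◁ g)`. -/
structure MatchedPair {P : Type u} (V H : GroupoidOver P) where
  left : LeftAction H V.src
  right : RightAction V H.tgt
  tgt_left : ∀ x g h, V.tgt (left.act x g h) = H.src (right.act x g h)
  left_comp : ∀ x f g (h : H.tgt x = V.src f) (h' : V.tgt f = V.src g),
    left.act x (V.comp f g h') (h.trans (V.src_comp f g h').symm) =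
      V.comp (left.act x f h) (left.act (right.act x f h) g ((right.q_act x f h).trans h'))
        ((tgt_left x f h).trans (left.p_act _ _ _).symm)
  comp_right : ∀ x y g (h : H.tgt x = H.src y) (h' : H.tgt y = V.src g),
    right.act (H.comp x y h) g ((H.tgt_comp x y h).trans h') =
      H.comp (right.act x (left.act y g h') (h.trans (left.p_act y g h').symm))
        (right.act y g h') ((right.q_act _ _ _).trans (tgt_left y g h'))

/-- A quiver over `P`: a set with two maps to `P`. -/
structure QuivOver (P : Type u) where
  carrier : Type u
  p : carrier → P
  q : carrier → P

namespace QuivOver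

variable {P : Type u}

/-- A morphism of quivers over `P`: a map that commutes with both maps to `P`. -/
@[ext]
structure Hom (X Y : QuivOver P) where
  toFun : X.carrier → Y.carrier
  p_toFun : ∀ e, Y.p (toFun e) = X.p e
  q_toFun : ∀ e, Y.q (toFun e) = X.q e

/-- The category of quivers over `P`. -/
instance : Category (QuivOver P) where
  Hom := Hom
  id X := ⟨fun e => e, fun _ => rfl, fun _ => rfl⟩
  comp f g := ⟨fun e => g.toFun (f.toFun e), fun e => (g.p_toFun _).trans (f.p_toFun e),
    fun e => (g.q_toFun _).trans (f.q_toFun e)⟩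

end QuivOver

namespace MatchedPair

variable {P : Type u} {V H : GroupoidOver P} (M : MatchedPair V H)

attribute [simp] tgt_left

@[simp]
theorem src_left (x : H.Arr) (g : V.Arr) (h : H.tgt x = V.src g) :
    V.src (M.left.act x g h) = H.src x :=
  M.left.p_act x g h

@[simp]
theorem tgt_right (x : H.Arr) (g : V.Arr) (h : H.tgt x = V.src g) :
    H.tgt (M.right.act x g h) = V.tgt g :=
  M.right.q_act x g h

theorem left_one (x : H.Arr) (a : P) (h : H.tgt x = a) :
    M.left.act x (V.one a) (by simpa using h) = V.one (H.src x) := by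
  subst h
  have h1 := M.left_comp x (V.one (H.tgt x)) (V.one (H.tgt x)) (by simp) (by simp)
  have h2 : V.comp (V.one (H.tgt x)) (V.one (H.tgt x)) (by simp) = V.one (H.tgt x) := by
    simpa using V.one_comp (V.one (H.tgt x))
  simp only [h2, M.right.act_one] at h1
  refine V.comp_left_cancel (f := M.left.act x (V.one (H.tgt x)) (by simp)) (by simp [M.right.act_one])
    (by simp [M.right.act_one]) (h1.symm.trans ?_)
  have h3 := V.comp_one (M.left.act x (V.one (H.tgt x)) (by simp))
  simp only [M.tgt_left, M.right.act_one] at h3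
  exact h3.symm

theorem right_one (x : H.Arr) (a : P) (h : H.tgt x = a) :
    M.right.act x (V.one a) (by simpa using h) = x := by
  subst h
  exact M.right.act_one x

theorem one_right (g : V.Arr) (a : P) (h : a = V.src g) :
    M.right.act (H.one a) g (by simpa using h) = H.one (V.tgt g) := by
  subst h
  have h1 := M.comp_right (H.one (V.src g)) (H.one (V.src g)) g (by simp) (by simp)
  have h2 : H.comp (H.one (V.src g)) (H.one (V.src g)) (by simp) = H.one (V.src g) := by
    simpa using H.one_comp (H.one (V.src g))
  simp only [h2, M.left.one_act] at h1
  refine H.comp_left_cancel (f := M.right.act (H.one (V.src g)) g (by simp))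
    (by simp [← M.tgt_left, M.left.one_act])
    (by simp) (h1.symm.trans ?_)
  have h3 := H.comp_one (M.right.act (H.one (V.src g)) g (by simp))
  simp only [M.tgt_right] at h3
  exact h3.symm

/-- A pair `(f, y)` of an arrow of `V` and an arrow of `H` with `b(f) = l(y)`. -/
@[ext]
structure DiagArr (M : MatchedPair V H) where
  fst : V.Arr
  snd : H.Arr
  comm : V.tgt fst = H.src snd

/-- The diagonal groupoid `V ⋈ H` of a matched pair: its arrows are the pairs `(f, y)` with
`b(f) = l(y)`, and `(f, y)(h, z) = (f(y ▷ h), (y ◁ h)z)`. -/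
def diagonal : GroupoidOver P where
  Arr := M.DiagArr
  src a := V.src a.fst
  tgt a := H.tgt a.snd
  one a := ⟨V.one a, H.one a, by simp⟩
  inv a := ⟨M.left.act (H.inv a.snd) (V.inv a.fst) (by simp [a.comm]),
    M.right.act (H.inv a.snd) (V.inv a.fst) (by simp [a.comm]), by simp⟩
  comp a b h := ⟨V.comp a.fst (M.left.act a.snd b.fst h) (by simp [a.comm]),
    H.comp (M.right.act a.snd b.fst h) b.snd (by simp [b.comm]), by simp⟩
  src_one a := by simp
  tgt_one a := by simp
  src_inv a := by simp
  tgt_inv a := by simp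
  src_comp a b h := by simp
  tgt_comp a b h := by simp
  one_comp := by
    rintro ⟨f, y, h⟩
    ext
    · simp [M.left.one_act]
    · simp [M.one_right, h]
  comp_one := by
    rintro ⟨f, y, h⟩
    ext
    · simp [M.left_one, ← h]
    · simp [M.right.act_one]
  comp_assoc := by
    rintro ⟨f, y, h⟩ ⟨f', y', h'⟩ ⟨f'', y'', h''⟩ e e'
    dsimp only at h h' h'' e e'
    ext
    · simp only [M.left_comp y f' (M.left.act y' f'' e') e (by simp [h'])]
      simp only [M.left.act_act _ _ _ (show H.tgt (M.right.act y f' e) = H.src y' by simp [h']) e']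
      exact V.comp_assoc _ _ _ (by simp [h]) (by simp)
    · simp only [M.comp_right (M.right.act y f' e) y' f'' (by simp [h']) e']
      simp only [M.right.act_act _ _ _ e (show V.tgt f' = V.src (M.left.act y' f'' e') by simp [h'])]
      exact H.comp_assoc _ _ _ (by simp) (by simp [h''])
  inv_comp := by
    rintro ⟨f, y, h⟩
    ext
    · have := M.left_comp (H.inv y) (V.inv f) f (by simp [h]) (by simp)
      simp only [← this, V.inv_comp]
      rw [M.left_one _ _ (by simp [h])]; simp
    · simp only [M.right.act_act _ _ _ (show H.tgt (H.inv y) = V.src (V.inv f) by simp [h])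
        (show V.tgt (V.inv f) = V.src f by simp), V.inv_comp]
      have := M.right.act_one (H.inv y)
      simp only [H.tgt_inv] at this
      simp [h, this]
  comp_inv := by
    rintro ⟨f, y, h⟩
    ext
    · simp only [M.left.act_act _ _ _ (show H.tgt y = H.src (H.inv y) by simp)
        (show H.tgt (H.inv y) = V.src (V.inv f) by simp [h]), H.comp_inv]
      have := M.left.one_act (V.inv f)
      simp only [V.src_inv] at this
      simp [← h, this]
    · have := M.comp_right y (H.inv y) (V.inv f) (by simp) (by simp [h])
      simp only [← this, H.comp_inv]
      rw [M.one_right _ _ (by simp [h])]; simp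

/-- The arrow `f` of `V`, as an arrow of the diagonal groupoid. -/
def inclV (f : V.Arr) : M.diagonal.Arr := ⟨f, H.one (V.tgt f), by simp⟩

/-- The arrow `y` of `H`, as an arrow of the diagonal groupoid. -/
def inclH (y : H.Arr) : M.diagonal.Arr := ⟨V.one (H.src y), y, by simp⟩

@[simp] theorem src_inclV (f : V.Arr) : M.diagonal.src (M.inclV f) = V.src f := id rfl

@[simp] theorem tgt_inclV (f : V.Arr) : M.diagonal.tgt (M.inclV f) = V.tgt f := by
  simp [inclV, diagonal]

@[simp] theorem src_inclH (y : H.Arr) : M.diagonal.src (M.inclH y) = H.src y := by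
  simp [inclH, diagonal]

@[simp] theorem tgt_inclH (y : H.Arr) : M.diagonal.tgt (M.inclH y) = H.tgt y := id rfl

theorem inclV_comp_inclH (f : V.Arr) (y : H.Arr) (h : V.tgt f = H.src y) :
    M.diagonal.comp (M.inclV f) (M.inclH y) (by simp [h]) = ⟨f, y, h⟩ := by
  apply DiagArr.ext
  · simp [inclV, inclH, diagonal, M.left_one, ← h]
  · simp [inclV, inclH, diagonal, h]
    have := M.right.act_one (H.one (H.src y))
    simp only [H.tgt_one] at this
    simp [this]

theorem inclH_comp_inclV (x : H.Arr) (g : V.Arr) (h : H.tgt x = V.src g) :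
    M.diagonal.comp (M.inclH x) (M.inclV g) (by simp [h]) =
      ⟨M.left.act x g h, M.right.act x g h, by simp⟩ := by
  apply DiagArr.ext
  · have := V.one_comp (M.left.act x g h)
    simp only [src_left] at this
    simpa [inclV, inclH, diagonal]
  · have := H.comp_one (M.right.act x g h)
    simp only [tgt_right] at this
    simpa [inclV, inclH, diagonal]

theorem inclV_comp (f g : V.Arr) (h : V.tgt f = V.src g) :
    M.inclV (V.comp f g h) =
      M.diagonal.comp (M.inclV f) (M.inclV g) (by simp [h]) := by
  have h1 : M.left.act (H.one (V.src g)) g (by simp) = g := M.left.one_act g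
  have h2 := H.one_comp (H.one (V.tgt g))
  simp only [H.src_one] at h2
  apply DiagArr.ext
  · simp [inclV, diagonal, h, h1]
  · simp [inclV, diagonal, M.one_right, h, h2]

theorem inclH_comp (x y : H.Arr) (h : H.tgt x = H.src y) :
    M.inclH (H.comp x y h) =
      M.diagonal.comp (M.inclH x) (M.inclH y) (by simp [h]) := by
  have h1 : M.right.act x (V.one (H.tgt x)) (by simp) = x := M.right.act_one x
  have h2 := V.one_comp (V.one (H.src x))
  simp only [V.src_one] at h2
  apply DiagArr.ext
  · simp [inclH, diagonal, M.left_one, ← h, h2]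
  · simp [inclH, diagonal, ← h, h1]

theorem inclV_one (a : P) : M.inclV (V.one a) = M.diagonal.one a := by
  simp [inclV, diagonal]

theorem inclH_one (a : P) : M.inclH (H.one a) = M.diagonal.one a := by
  simp [inclH, diagonal]

theorem inclV_inv (f : V.Arr) : M.inclV (V.inv f) = M.diagonal.inv (M.inclV f) := by
  apply M.diagonal.eq_inv_of_comp_eq_one (by simp)
  rw [← M.inclV_comp _ _ (by simp)]
  simp [inclV_one]

theorem inclH_inv (y : H.Arr) : M.inclH (H.inv y) = M.diagonal.inv (M.inclH y) := by
  apply M.diagonal.eq_inv_of_comp_eq_one (by simp)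
  rw [← M.inclH_comp _ _ (by simp)]
  simp [inclH_one]

section Double

variable (g : V.Arr) (h : H.Arr) (γ : V.Arr) (x : H.Arr) (hg : V.tgt g = H.src h)
  (hγ : H.tgt h = V.src γ) (hx : V.src γ = H.tgt x) (hx' : V.tgt γ = H.src x)

/-- The arrow `Ω = (h ◁ γ) x h⁻¹` of `H`. -/
def omega : H.Arr :=
  H.comp (H.comp (M.right.act h γ hγ) x (by simp [hx'])) (H.inv h) (by simp [← hx, hγ])

@[simp]
theorem src_omega :
    H.src (M.omega h γ x hγ hx hx') = H.src (M.right.act h γ hγ) := by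
  simp [omega]

@[simp]
theorem tgt_omega : H.tgt (M.omega h γ x hγ hx hx') = H.src h := by
  simp [omega]

/-- The action `(g, h) ⇀ (γ, x) = (g (h ▷ γ) (Ω ▷ g⁻¹), Ω ◁ g⁻¹)` of the double, where
`Ω = (h ◁ γ) x h⁻¹`. -/
def doubleLeft : GroupoidOver.ProdArr V H.op where
  fst := V.comp (V.comp g (M.left.act h γ hγ) (by simp [hg]))
    (M.left.act (M.omega h γ x hγ hx hx') (V.inv g) (by simp [hg])) (by simp)
  snd := M.right.act (M.omega h γ x hγ hx hx') (V.inv g) (by simp [hg])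
  src_eq := by simp [GroupoidOver.op]
  tgt_eq := by simp [GroupoidOver.op]

/-- The action `(g, h) ↼ (γ, x) = ((Ω ◁ g⁻¹) ▷ g, h ◁ γ)` of the double, where
`Ω = (h ◁ γ) x h⁻¹`. -/
def doubleRight : M.DiagArr where
  fst := M.left.act (M.right.act (M.omega h γ x hγ hx hx') (V.inv g) (by simp [hg])) g (by simp)
  snd := M.right.act h γ hγ
  comm := by
    have e := M.right.act_one (M.omega h γ x hγ hx hx')
    simp only [tgt_omega] at e
    rw [M.tgt_left]
    simp only [M.right.act_act (M.omega h γ x hγ hx hx') (V.inv g) g (by simp [hg]) (by simp),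
      V.inv_comp, hg, e]
    simp

/-- The arrow `γ x` of the diagonal groupoid, for a pair of arrows `(γ, x)` such that
`t(γ) = r(x)` and `b(γ) = l(x)`. -/
def loop (s : GroupoidOver.ProdArr V H.op) : M.diagonal.Arr := DiagArr.mk s.fst s.snd s.tgt_eq

theorem loop_eq (s : GroupoidOver.ProdArr V H.op) : M.loop s =
    M.diagonal.comp (M.inclV s.fst) (M.inclH s.snd) ((M.tgt_inclV _).trans (s.tgt_eq.trans (M.src_inclH _).symm)) :=
  (M.inclV_comp_inclH s.fst s.snd s.tgt_eq).symm

theorem diag_eq (a : M.diagonal.Arr) : a =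
    M.diagonal.comp (M.inclV (DiagArr.fst a)) (M.inclH (DiagArr.snd a))
      ((M.tgt_inclV _).trans ((DiagArr.comm a).trans (M.src_inclH _).symm)) :=
  (M.inclV_comp_inclH _ _ (DiagArr.comm a)).symm

theorem cell (x : H.Arr) (g : V.Arr) (h : H.tgt x = V.src g) :
    M.diagonal.comp (M.inclV (M.left.act x g h)) (M.inclH (M.right.act x g h)) (by simp) =
    M.diagonal.comp (M.inclH x) (M.inclV g) (by simp [h]) := by
  rw [M.inclH_comp_inclV x g h, M.inclV_comp_inclH _ _ (by simp)]

theorem cell_assoc (x : H.Arr) (g : V.Arr) (h : H.tgt x = V.src g) (k : M.diagonal.Arr)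
    (hk : M.diagonal.tgt (M.inclH (M.right.act x g h)) = M.diagonal.src k) :
    M.diagonal.comp (M.inclV (M.left.act x g h)) (M.diagonal.comp (M.inclH (M.right.act x g h)) k
      hk) (by simp) =
    M.diagonal.comp (M.inclH x) (M.diagonal.comp (M.inclV g) k (by simpa using hk))
      (by simp [h]) := by
  rw [← M.diagonal.comp_assoc _ _ _ (by simp) hk,
    ← M.diagonal.comp_assoc _ _ _ (by simp [h]) (by simpa using hk)]
  simp only [M.cell]

theorem loop_doubleLeft : M.loop (M.doubleLeft g h γ x hg hγ hx hx') =
    M.diagonal.comp (M.inclV g) (M.diagonal.comp (M.inclH h) (M.diagonal.comp (M.inclV γ)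
      (M.diagonal.comp (M.inclH x) (M.diagonal.comp (M.diagonal.inv (M.inclH h))
        (M.diagonal.inv (M.inclV g)) (by simp [hg])) (by simp [← hx, hγ])) (by simp [hx']))
        (by simp [hγ])) (by simp [hg]) := by
  simp only [loop_eq, doubleLeft, inclV_comp, M.diagonal.comp_assoc', M.cell]
  simp only [omega, inclH_comp, M.diagonal.comp_assoc', M.cell_assoc, inclH_inv, inclV_inv]

theorem doubleLeft_fst_comp :
    V.comp (M.doubleLeft g h γ x hg hγ hx hx').fst (M.doubleRight g h γ x hg hγ hx hx').fst
      (by simp [doubleLeft, doubleRight]) = V.comp g (M.left.act h γ hγ) (by simp [hg]) := by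
  have e := M.left_comp (M.omega h γ x hγ hx hx') (V.inv g) g (by simp [hg]) (by simp)
  simp only [V.inv_comp] at e
  rw [M.left_one _ _ (by simp [hg])] at e
  simp only [doubleLeft, doubleRight, V.comp_assoc', ← e]
  have e' := V.comp_one (M.left.act h γ hγ)
  simp only [tgt_left] at e'
  simp [e']

end Double

/-- The vertical groupoid of the double: the restricted product of `V` and `H^op`. Its arrows are
the pairs `(γ, x)` with `t(γ) = r(x)` and `b(γ) = l(x)`. -/
def doubleV (_ : MatchedPair V H) : GroupoidOver P := V.restrictedProd H.op

/-- The first component `γ` of an arrow `(γ, x)` of the vertical groupoid of the double. -/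
def fstArr (s : M.doubleV.Arr) : V.Arr := GroupoidOver.ProdArr.fst (G := V) (K := H.op) s

/-- The second component `x` of an arrow `(γ, x)` of the vertical groupoid of the double. -/
def sndArr (s : M.doubleV.Arr) : H.Arr := GroupoidOver.ProdArr.snd (G := V) (K := H.op) s

theorem src_eq (s : M.doubleV.Arr) : V.src (M.fstArr s) = H.tgt (M.sndArr s) :=
  GroupoidOver.ProdArr.src_eq (G := V) (K := H.op) s

theorem tgt_eq (s : M.doubleV.Arr) : V.tgt (M.fstArr s) = H.src (M.sndArr s) :=
  GroupoidOver.ProdArr.tgt_eq (G := V) (K := H.op) s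

/-- The left action of `V ⋈ H` on the arrows of the restricted product of `V` and `H^op`. -/
def dLeft (a : M.diagonal.Arr) (s : M.doubleV.Arr) (h : M.diagonal.tgt a = M.doubleV.src s) :
    M.doubleV.Arr :=
  M.doubleLeft (DiagArr.fst a) (DiagArr.snd a) (M.fstArr s)
    (M.sndArr s) (DiagArr.comm a) h (M.src_eq s)
    (M.tgt_eq s)

/-- The right action of the restricted product of `V` and `H^op` on the arrows of `V ⋈ H`. -/
def dRight (a : M.diagonal.Arr) (s : M.doubleV.Arr) (h : M.diagonal.tgt a = M.doubleV.src s) :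
    M.diagonal.Arr :=
  M.doubleRight (DiagArr.fst a) (DiagArr.snd a) (M.fstArr s)
    (M.sndArr s) (DiagArr.comm a) h (M.src_eq s)
    (M.tgt_eq s)

/-- The first component of an arrow of the restricted product, in the diagonal groupoid. -/
def pV (s : M.doubleV.Arr) : M.diagonal.Arr := M.inclV (M.fstArr s)

/-- The second component of an arrow of the restricted product, in the diagonal groupoid. -/
def pH (s : M.doubleV.Arr) : M.diagonal.Arr := M.inclH (M.sndArr s)

@[simp] theorem src_pV (s) : M.diagonal.src (M.pV s) = M.doubleV.src s := id rfl

@[simp] theorem tgt_pV (s) : M.diagonal.tgt (M.pV s) = M.doubleV.tgt s := M.tgt_inclV _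

@[simp] theorem src_pH (s) : M.diagonal.src (M.pH s) = M.doubleV.tgt s :=
  (M.src_inclH _).trans (M.tgt_eq s).symm

@[simp] theorem tgt_pH (s) : M.diagonal.tgt (M.pH s) = M.doubleV.src s :=
  id (M.src_eq s).symm

theorem pV_comp (s s' : M.doubleV.Arr) (h : M.doubleV.tgt s = M.doubleV.src s') :
    M.pV (M.doubleV.comp s s' h) = M.diagonal.comp (M.pV s) (M.pV s') (by simp [h]) :=
  M.inclV_comp _ _ h

theorem pH_comp (s s' : M.doubleV.Arr) (h : M.doubleV.tgt s = M.doubleV.src s') :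
    M.pH (M.doubleV.comp s s' h) = M.diagonal.comp (M.pH s') (M.pH s) (by simp [h]) :=
  M.inclH_comp (M.sndArr s') (M.sndArr s) ((M.src_eq s').symm.trans (h.symm.trans (M.tgt_eq s)))

theorem pV_one (a : P) : M.pV (M.doubleV.one a) = M.diagonal.one a := M.inclV_one a

theorem pH_one (a : P) : M.pH (M.doubleV.one a) = M.diagonal.one a := M.inclH_one a

theorem arr_ext {s s' : M.doubleV.Arr} (e : M.diagonal.comp (M.pV s) (M.pH s) (by simp) =
      M.diagonal.comp (M.pV s') (M.pH s') (by simp)) : s = s' := by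
  have e1 := (M.inclV_comp_inclH _ _ (M.tgt_eq s)).symm.trans
    (Eq.trans e (M.inclV_comp_inclH _ _ (M.tgt_eq s')))
  injection e1 with e2 e3
  exact GroupoidOver.ProdArr.ext (G := V) (K := H.op) e2 e3

section Double

variable (a : M.diagonal.Arr) (s : M.doubleV.Arr) (h : M.diagonal.tgt a = M.doubleV.src s)

@[simp] theorem src_dLeft : M.doubleV.src (M.dLeft a s h) = M.diagonal.src a := by
  change V.src (V.comp _ _ _) = V.src _
  simp

@[simp] theorem tgt_dRight : M.diagonal.tgt (M.dRight a s h) = M.doubleV.tgt s := by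
  change H.tgt (M.right.act _ _ _) = V.tgt _
  exact M.tgt_right _ _ _

@[simp] theorem tgt_dLeft : M.doubleV.tgt (M.dLeft a s h) = M.diagonal.src (M.dRight a s h) := by
  change V.tgt (V.comp _ _ _) = V.src (M.left.act _ _ _)
  simp

theorem dLeft_dRight : M.diagonal.comp (M.pV (M.dLeft a s h)) (M.dRight a s h) (by simp) =
    M.diagonal.comp a (M.pV s) (by simp [h]) := by
  have e1 := M.doubleLeft_fst_comp (DiagArr.fst a) (DiagArr.snd a) (M.fstArr s) (M.sndArr s)
    (DiagArr.comm a) h (M.src_eq s) (M.tgt_eq s)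
  have e2 := congrArg M.inclV e1
  rw [M.inclV_comp, M.inclV_comp] at e2
  have e3 : M.dRight a s h = _ := M.diag_eq _
  refine (M.diagonal.comp_congr rfl e3 _ ?_).trans ?_
  · exact (M.tgt_pV _).trans (((M.tgt_dLeft a s h).trans (congrArg _ e3)))
  rw [← M.diagonal.comp_assoc _ _ _ (by
    exact (M.tgt_pV _).trans (((M.tgt_dLeft a s h).trans (congrArg _ e3)).trans
      (M.diagonal.src_comp _ _ _)))]
  refine (M.diagonal.comp_congr e2 rfl _ ?_).trans ?_
  · exact (M.diagonal.tgt_comp _ _ _).trans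
      ((M.tgt_inclV _).trans ((M.tgt_left _ _ _).trans (M.src_inclH _).symm))
  rw [M.diagonal.comp_assoc' ]
  refine (M.diagonal.comp_congr rfl (M.cell _ _ h) _ ?_).trans ?_
  · simpa using DiagArr.comm a
  rw [← M.diagonal.comp_assoc _ _ _ (by simpa using DiagArr.comm a) h]
  exact M.diagonal.comp_congr (M.diag_eq a).symm rfl _ _

theorem pV_pH_dLeft : M.diagonal.comp (M.pV (M.dLeft a s h)) (M.pH (M.dLeft a s h)) (by simp) =
    M.diagonal.comp a (M.diagonal.comp (M.pV s) (M.diagonal.comp (M.pH s) (M.diagonal.inv a)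
      (by simp [h])) (by simp)) (by simp [h]) := by
  have e := M.loop_doubleLeft (DiagArr.fst a) (DiagArr.snd a) (M.fstArr s) (M.sndArr s)
    (DiagArr.comm a) h (M.src_eq s) (M.tgt_eq s)
  rw [M.loop_eq] at e
  exact Eq.trans e (M.diagonal.conj_of_eq (M.diag_eq a) (M.pV s) (M.pH s) h
    (by simp) (by simp [h]) ((M.tgt_inclH _).trans h) ((M.tgt_pH s).trans h.symm)).symm

theorem pH_dLeft : M.pH (M.dLeft a s h) =
    M.diagonal.comp (M.dRight a s h) (M.diagonal.comp (M.pH s) (M.diagonal.inv a)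
      (by simp [h])) (by simp) := by
  apply M.diagonal.comp_left_cancel (f := M.pV (M.dLeft a s h)) (by simp) (by simp)
  rw [M.pV_pH_dLeft, ← M.diagonal.comp_assoc _ _ _ (by simp [h]) (by simp)]
  refine (M.diagonal.comp_congr (M.dLeft_dRight a s h).symm rfl _ (by simp)).trans ?_
  rw [M.diagonal.comp_assoc']

theorem dLeft_dRight_assoc (k : M.diagonal.Arr)
    (hk : M.diagonal.tgt (M.dRight a s h) = M.diagonal.src k) :
    M.diagonal.comp (M.pV (M.dLeft a s h)) (M.diagonal.comp (M.dRight a s h) k hk) (by simp) =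
      M.diagonal.comp a (M.diagonal.comp (M.pV s) k (by simpa using hk)) (by simp [h]) := by
  rw [← M.diagonal.comp_assoc _ _ _ (by simp) hk,
    ← M.diagonal.comp_assoc _ _ _ (by simp [h]) (by simpa using hk)]
  simp only [dLeft_dRight]

theorem pV_pH_dLeft_assoc (k : M.diagonal.Arr)
    (hk : M.diagonal.tgt (M.pH (M.dLeft a s h)) = M.diagonal.src k) :
    M.diagonal.comp (M.pV (M.dLeft a s h)) (M.diagonal.comp (M.pH (M.dLeft a s h)) k hk)
      (by simp) = M.diagonal.comp a (M.diagonal.comp (M.pV s) (M.diagonal.comp (M.pH s)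
        (M.diagonal.comp (M.diagonal.inv a) k (by simpa using hk))
      (by simp [h])) (by simp)) (by simp [h]) := by
  rw [← M.diagonal.comp_assoc _ _ _ (by simp) hk]
  simp only [pV_pH_dLeft, M.diagonal.comp_assoc']

theorem dLeft_comp (s' : M.doubleV.Arr) (h' : M.doubleV.tgt s = M.doubleV.src s') :
    M.dLeft a (M.doubleV.comp s s' h') (by simp [h]) =
      M.doubleV.comp (M.dLeft a s h) (M.dLeft (M.dRight a s h) s' (by simp [h'])) (by simp) := by
  apply M.arr_ext
  simp only [pV_pH_dLeft, pV_comp, pH_comp, M.diagonal.comp_assoc', pV_pH_dLeft_assoc]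
  simp only [M.pH_dLeft a s h, GroupoidOver.inv_comp_cancel, dLeft_dRight_assoc]

theorem dLeft_one (b : P) (hb : M.diagonal.tgt a = b) :
    M.dLeft a (M.doubleV.one b) (by simp [hb]) = M.doubleV.one (M.diagonal.src a) := by
  subst hb
  apply M.arr_ext
  have e := M.diagonal.one_comp (M.diagonal.inv a)
  have e' := M.diagonal.one_comp (M.diagonal.one (M.diagonal.src a))
  simp only [M.diagonal.src_inv, M.diagonal.src_one] at e e'
  simp only [pV_pH_dLeft, pV_one, pH_one, e, M.diagonal.comp_inv, e']

theorem dLeft_act (b : M.diagonal.Arr) (h' : M.diagonal.tgt b = M.diagonal.src a) :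
    M.dLeft b (M.dLeft a s h) (by simp [h']) = M.dLeft (M.diagonal.comp b a h') s (by simp [h]) := by
  apply M.arr_ext
  simp only [pV_pH_dLeft, M.diagonal.inv_comp_rev, M.diagonal.comp_assoc', pV_pH_dLeft_assoc]

theorem dRight_comp (s' : M.doubleV.Arr) (h' : M.doubleV.tgt s = M.doubleV.src s') :
    M.dRight (M.dRight a s h) s' (by simp [h']) =
      M.dRight a (M.doubleV.comp s s' h') (by simp [h]) := by
  apply M.diagonal.comp_left_cancel (f := M.pV (M.dLeft a (M.doubleV.comp s s' h') (by simp [h])))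
    (by simp [dLeft_comp, h]) (by simp)
  rw [dLeft_dRight]
  simp only [dLeft_comp, pV_comp, M.diagonal.comp_assoc', dLeft_dRight, dLeft_dRight_assoc, h]

theorem comp_dRight (b : M.diagonal.Arr) (h' : M.diagonal.tgt b = M.diagonal.src a) :
    M.dRight (M.diagonal.comp b a h') s (by simp [h]) =
      M.diagonal.comp (M.dRight b (M.dLeft a s h) (by simp [h'])) (M.dRight a s h) (by simp) := by
  apply M.diagonal.comp_left_cancel
    (f := M.pV (M.dLeft (M.diagonal.comp b a h') s (by simp [h])))
    (by simp) (by simp [← dLeft_act, h])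
  rw [dLeft_dRight]
  simp only [← dLeft_act, M.diagonal.comp_assoc', dLeft_dRight, dLeft_dRight_assoc, h]

theorem one_dLeft (s : M.doubleV.Arr) :
    M.dLeft (M.diagonal.one (M.doubleV.src s)) s (by simp) = s := by
  apply M.arr_ext
  have e := M.diagonal.one_comp (M.diagonal.comp (M.pV s) (M.pH s) (by simp))
  have e' := M.diagonal.comp_one (M.pH s)
  simp only [M.diagonal.src_comp, src_pV, tgt_pH] at e e'
  simp only [M.pV_pH_dLeft, M.diagonal.inv_one, e', e]

theorem dRight_one (a : M.diagonal.Arr) :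
    M.dRight a (M.doubleV.one (M.diagonal.tgt a)) (by simp) = a := by
  apply M.diagonal.comp_left_cancel
    (f := M.pV (M.dLeft a (M.doubleV.one (M.diagonal.tgt a)) (by simp)))
    (by simp) (by simp [dLeft_one])
  rw [dLeft_dRight]
  simp [pV_one, dLeft_one]

end Double

/-- The double `D(V, H)`: the matched pair formed by the restricted product of `V` and `H^op`
(vertical) and the diagonal groupoid `V ⋈ H` (horizontal), with the actions
`(g, h) ⇀ (γ, x) = (g (h ▷ γ) (Ω ▷ g⁻¹), Ω ◁ g⁻¹)` and
`(g, h) ↼ (γ, x) = ((Ω ◁ g⁻¹) ▷ g, h ◁ γ)`, where `Ω = (h ◁ γ) x h⁻¹`. -/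
def double : MatchedPair M.doubleV M.diagonal where
  left :=
    { act := M.dLeft
      p_act := M.src_dLeft
      act_act := fun b a s h' h => M.dLeft_act a s h b h'
      one_act := M.one_dLeft }
  right :=
    { act := M.dRight
      q_act := M.tgt_dRight
      act_act := fun a s s' h h' => M.dRight_comp a s h s' h'
      act_one := M.dRight_one }
  tgt_left := M.tgt_dLeft
  left_comp a s s' h h' := M.dLeft_comp a s h s' h'
  comp_right b a s h' h := M.comp_dRight a s h b h'

/-- A (set-theoretic) representation of the matched pair `(V, H)`: a quiver over `P` with a left
action of `H` on its map `p` and a grading (degree map) over `V`, subject to the two compatibility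
conditions. -/
structure Rep (M : MatchedPair V H) extends QuivOver P where
  action : LeftAction H p
  deg : carrier → V.Arr
  p_eq : ∀ e, p e = V.src (deg e)
  q_eq : ∀ e, q e = V.tgt (deg e)
  deg_act : ∀ x e (h : H.tgt x = p e),
    deg (action.act x e h) = M.left.act x (deg e) (h.trans (p_eq e))

namespace Rep

variable {M}

/-- A morphism of representations: a map that intertwines the actions and preserves the
gradings (and hence `p` and `q`). -/
@[ext]
structure Hom (E F : M.Rep) extends QuivOver.Hom E.toQuivOver F.toQuivOver where
  deg_toFun : ∀ e, F.deg (toFun e) = E.deg e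
  act_toFun : ∀ x e (h : H.tgt x = E.p e),
    toFun (E.action.act x e h) = F.action.act x (toFun e) (h.trans (p_toFun e).symm)

/-- The category `Rep(V, H)`. -/
instance : Category M.Rep where
  Hom := Hom
  id E := ⟨⟨fun e => e, fun _ => rfl, fun _ => rfl⟩, fun _ => rfl, fun _ _ _ => rfl⟩
  comp f g := ⟨⟨fun e => g.toFun (f.toFun e), fun e => (g.p_toFun _).trans (f.p_toFun e),
      fun e => (g.q_toFun _).trans (f.q_toFun e)⟩,
    fun e => (g.deg_toFun _).trans (f.deg_toFun e),
    fun x e h => (congrArg g.toFun (f.act_toFun x e h)).trans (g.act_toFun _ _ _)⟩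

theorem hom_ext {E F : M.Rep} {f g : E ⟶ F} (h : ∀ e, f.toFun e = g.toFun e) : f = g :=
  Hom.ext (funext h)

variable (M) in
/-- The forgetful functor from `Rep(V, H)` to quivers over `P`. -/
def forget : M.Rep ⥤ QuivOver P where
  obj E := E.toQuivOver
  map f := f.toHom

@[simp]
theorem q_act (E : M.Rep) (x : H.Arr) (e : E.carrier) (h : H.tgt x = E.p e) :
    E.q (E.action.act x e h) = H.src (M.right.act x (E.deg e) (h.trans (E.p_eq e))) := by
  rw [E.q_eq, E.deg_act, M.tgt_left]

theorem act_congr (E : M.Rep) {x x' : H.Arr} {e e' : E.carrier} (hx : x = x') (he : e = e')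
    (h : H.tgt x = E.p e) (h' : H.tgt x' = E.p e') :
    E.action.act x e h = E.action.act x' e' h' := by
  subst hx he; rfl

/-- The tensor product of representations: its underlying set consists of the pairs `(e, f)` with
`q(e) = p(f)`, the action is `x ▷ (e, f) = (x ▷ e, (x ◁ |e|) ▷ f)` and `|(e, f)| = |e||f|`. -/
def tensor (E F : M.Rep) : M.Rep where
  carrier := {a : E.carrier × F.carrier // E.q a.1 = F.p a.2}
  p a := E.p a.1.1
  q a := F.q a.1.2
  action :=
    { act := fun x a h => ⟨(E.action.act x a.1.1 h,
        F.action.act (M.right.act x (E.deg a.1.1) (h.trans (E.p_eq _))) a.1.2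
          (by rw [tgt_right, ← E.q_eq, a.2])),
        by rw [q_act, F.action.p_act]⟩
      p_act := fun x a h => E.action.p_act _ _ _
      act_act := by
        rintro x y ⟨⟨e, f⟩, ha⟩ h h'
        apply Subtype.ext
        ext1
        · exact E.action.act_act x y e h h'
        · refine (F.action.act_act _ _ _ ?_ ?_).trans (F.act_congr ?_ rfl _ _)
          · simp [E.deg_act]
          · rw [M.comp_right x y _ h (h'.trans (E.p_eq e))]
            simp only [E.deg_act]
      one_act := by
        rintro ⟨⟨e, f⟩, ha⟩
        apply Subtype.ext
        ext1
        · exact E.action.one_act e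
        · refine (F.act_congr ?_ rfl _ (by simp)).trans (F.action.one_act f)
          rw [M.one_right _ _ (E.p_eq e), ← E.q_eq, ha] }
  deg a := V.comp (E.deg a.1.1) (F.deg a.1.2) (by rw [← E.q_eq, ← F.p_eq, a.2])
  p_eq a := by rw [V.src_comp, E.p_eq]
  q_eq a := by rw [V.tgt_comp, F.q_eq]
  deg_act x a h := by
    simp only [E.deg_act, F.deg_act]
    exact (M.left_comp _ _ _ _ _).symm

variable (M) in
/-- The unit representation: the set `P` with `p` and `q` the identity maps, `x ▷ r(x) = l(x)` and
`|a|` the identity arrow of `V` at `a`. -/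
def unit : M.Rep where
  carrier := P
  p a := a
  q a := a
  action :=
    { act := fun x _ _ => H.src x
      p_act := fun _ _ _ => rfl
      act_act := fun x y _ _ _ => (H.src_comp x y _).symm
      one_act := fun a => H.src_one a }
  deg a := V.one a
  p_eq a := (V.src_one a).symm
  q_eq a := (V.tgt_one a).symm
  deg_act x a h := (M.left_one x a h).symm

/-- The tensor product of morphisms of representations. -/
def tensorMap {E F E' F' : M.Rep} (f : E ⟶ F) (g : E' ⟶ F') : E.tensor E' ⟶ F.tensor F' where
  toFun a := ⟨(f.toFun a.1.1, g.toFun a.1.2), by rw [f.q_toFun, g.p_toFun, a.2]⟩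
  p_toFun a := f.p_toFun _
  q_toFun a := g.q_toFun _
  deg_toFun a := by simp only [tensor, f.deg_toFun, g.deg_toFun]
  act_toFun x a h := by
    apply Subtype.ext
    ext1
    · exact f.act_toFun _ _ _
    · exact (g.act_toFun _ _ _).trans (F'.act_congr (by simp only [f.deg_toFun]) rfl _ _)

/-- A bijective morphism of representations, as an isomorphism. -/
def isoOfInverse {E F : M.Rep} (f : E ⟶ F) (g : F.carrier → E.carrier)
    (h : ∀ e, g (f.toFun e) = e) (h' : ∀ e, f.toFun (g e) = e) : E ≅ F where
  hom := f
  inv :=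
    { toFun := g
      p_toFun := fun e => by rw [← f.p_toFun, h']
      q_toFun := fun e => by rw [← f.q_toFun, h']
      deg_toFun := fun e => by rw [← f.deg_toFun, h']
      act_toFun := fun x e he => by
        rw [← h (E.action.act x (g e) _), f.act_toFun]
        simp only [h'] }
  hom_inv_id := hom_ext h
  inv_hom_id := hom_ext h'

/-- The associativity isomorphism `((e, f), k) ↦ (e, (f, k))`. -/
def assoc (E F K : M.Rep) : (E.tensor F).tensor K ≅ E.tensor (F.tensor K) :=
  isoOfInverse
    { toFun := fun a => ⟨(a.1.1.1.1, ⟨(a.1.1.1.2, a.1.2), a.2⟩), a.1.1.2⟩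
      p_toFun := fun _ => rfl
      q_toFun := fun _ => rfl
      deg_toFun := fun _ => (V.comp_assoc _ _ _ _ _).symm
      act_toFun := fun x a h => by
        apply Subtype.ext
        ext1
        · rfl
        apply Subtype.ext
        ext1
        · rfl
        · exact K.act_congr (M.right.act_act _ _ _ _ _).symm rfl _ _ }
    (fun a => ⟨(⟨(a.1.1, a.1.2.1.1), a.2⟩, a.1.2.1.2), a.1.2.2⟩) (fun _ => rfl) (fun _ => rfl)

/-- The left unit isomorphism `(p(e), e) ↦ e`. -/
def leftUnit (E : M.Rep) : (unit M).tensor E ≅ E :=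
  isoOfInverse
    { toFun := fun a => a.1.2
      p_toFun := fun a => a.2.symm
      q_toFun := fun _ => rfl
      deg_toFun := by
        rintro ⟨⟨a, e⟩, h⟩
        obtain rfl : a = E.p e := h
        have e1 := V.one_comp (E.deg e)
        simp only [tensor, unit, E.p_eq, e1]
      act_toFun := by
        rintro x ⟨⟨a, e⟩, h⟩ hx
        obtain rfl : a = E.p e := h
        exact E.act_congr (M.right_one x _ hx) rfl _ _ }
    (fun e => ⟨(E.p e, e), rfl⟩)
    (by
      rintro ⟨⟨a, e⟩, h⟩
      obtain rfl : a = E.p e := h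
      rfl)
    (fun _ => rfl)

/-- The right unit isomorphism `(e, q(e)) ↦ e`. -/
def rightUnit (E : M.Rep) : E.tensor (unit M) ≅ E :=
  isoOfInverse
    { toFun := fun a => a.1.1
      p_toFun := fun _ => rfl
      q_toFun := fun a => a.2
      deg_toFun := by
        rintro ⟨⟨e, a⟩, h⟩
        obtain rfl : E.q e = a := h
        have e1 := V.comp_one (E.deg e)
        simp only [tensor, unit, E.q_eq, e1]
      act_toFun := fun _ _ _ => rfl }
    (fun e => ⟨(e, E.q e), rfl⟩)
    (by
      rintro ⟨⟨e, a⟩, h⟩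
      obtain rfl : E.q e = a := h
      rfl)
    (fun _ => rfl)

/-- The monoidal structure of `Rep(V, H)`. -/
instance : MonoidalCategory M.Rep :=
  letI : MonoidalCategoryStruct M.Rep :=
    { tensorObj := tensor
      tensorHom := tensorMap
      whiskerLeft := fun E _ _ f => tensorMap (𝟙 E) f
      whiskerRight := fun f E => tensorMap f (𝟙 E)
      tensorUnit := unit M
      associator := assoc
      leftUnitor := leftUnit
      rightUnitor := rightUnit }
  MonoidalCategory.ofTensorHom
    (id_tensorHom_id := fun _ _ => rfl)
    (tensorHom_comp_tensorHom := fun _ _ _ _ => rfl)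
    (associator_naturality := fun _ _ _ => rfl)
    (leftUnitor_naturality := fun _ => rfl)
    (rightUnitor_naturality := fun _ => rfl)
    (pentagon := fun _ _ _ _ => rfl)
    (triangle := fun E F => by
      apply hom_ext
      rintro ⟨⟨⟨⟨e, a⟩, h⟩, f⟩, h'⟩
      rfl)

end Rep

end MatchedPair

/-- A monoidal functor is strict if its structure morphisms `𝟙 ⟶ F(𝟙)` and
`F(X) ⊗ F(Y) ⟶ F(X ⊗ Y)` are identities. -/
structure IsStrictMonoidal {C D : Type*} [Category* C] [Category* D] [MonoidalCategory C]
    [MonoidalCategory D] (F : C ⥤ D) [F.Monoidal] : Prop where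
  unit_eq : ∃ h : 𝟙_ D = F.obj (𝟙_ C), Functor.LaxMonoidal.ε F = eqToHom h
  tensor_eq : ∀ X Y : C, ∃ h : F.obj X ⊗ F.obj Y = F.obj (X ⊗ Y),
    Functor.LaxMonoidal.μ F X Y = eqToHom h

/-!
Let `E` be a representation of `(V, H)`. Both an extension of `E` to a representation of the double
and a half-braiding on `E` amount to the same data (`DoubleStructure`): an arrow
`x(e) : q(e) → p(e)` of `H` for every `e ∈ E`, and an action of `V` on `p : E → P`, compatible with
each other and with the action of `H` and the degree.

* For a representation of the double, `x(e)` is the component in `H` of the degree of `e`, and `V`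
  acts as a subgroupoid of `V ⋈ H`. Conversely `(f, y) ∈ V ⋈ H` has to act by `y`, then by `f`
  (`restrictStructure`, `DoubleStructure.toRep`).
* The data define the half-braiding `(e, u) ↦ (x⁻¹ ▷ u, d⁻¹ ▷ e)` with `x = x(e)` and
  `d = |x⁻¹ ▷ u|` (`DoubleStructure.halfBraiding`).
* Conversely, let `F(g)` be the free representation on a generator of degree `g`. An element `u` of
  a representation is the image of the generator of `F(|u|)`, so a half-braiding `b` is determined
  by its values `b(e, 1_g) = (k, e')` on generators. The hexagon axiom on `F(g) ⊗ F(g')` shows that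
  `k` depends on `e` alone (`HalfBraiding.arrow_eq_arrow_one`), so that `x(e) = k⁻¹`, and that
  `g ↦ e'` is compatible with composition (`HalfBraiding.shift_shift`). It is also compatible with
  identities, since `b` is injective (`HalfBraiding.shift_one`). After transport along `x(e)` it is
  therefore an action of `V`.

Neither construction changes the underlying set of `E`, its maps to `P`, or the underlying sets of
tensor products. Hence all comparison morphisms are the identity on elements, and a morphism of
representations that is the identity on elements is an equality of objects (`eqToHom_of_id`,
`Center.eqToHom_of_eqToHom`). The monoidal structure on the functor from the center is the one
transported through the equivalence.
-/

/-! ### Groupoids and matched pairs -/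

namespace GroupoidOver

variable {P : Type u} (G : GroupoidOver P)

theorem one_comp_of_eq (f : G.Arr) (a : P) (h : a = G.src f) :
    G.comp (G.one a) f (by simpa using h) = f := by
  subst h
  exact G.one_comp f

theorem comp_one_of_eq (f : G.Arr) (a : P) (h : G.tgt f = a) :
    G.comp f (G.one a) (by simpa using h) = f := by
  subst h
  exact G.comp_one f

theorem comp_inv_comp (f g : G.Arr) (h : G.tgt f = G.tgt g) :
    G.comp (G.comp f (G.inv g) (by simpa using h)) g (by simp) = f := by
  rw [G.comp_assoc _ _ _ (by simpa using h) (by simp)]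
  exact (G.comp_congr rfl (G.inv_comp g) _ (by simpa using h)).trans (G.comp_one_of_eq f _ h)

theorem inv_inv (f : G.Arr) :
    G.inv (G.inv f) = f :=
  (G.eq_inv_of_comp_eq_one (by simp) (by simp)).symm

theorem comp_eq_comp_of_inv_comp {a c d f : G.Arr}
    (hac : G.tgt a = G.src c) (hdf : G.tgt d = G.src f) (had : G.src a = G.src d)
    (hcf : G.tgt c = G.tgt f)
    (e : G.comp (G.inv a) d (by simpa using had) = G.comp c (G.inv f) (by simpa using hcf)) :
    G.comp a c hac = G.comp d f hdf := by
  have h1 := G.comp_inv_cancel a d had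
  simp only [e] at h1
  simp only [← h1, G.comp_assoc', G.inv_comp]
  have h2 := G.comp_one c
  simp only [hcf] at h2
  exact G.comp_congr rfl h2.symm _ _

end GroupoidOver

namespace MatchedPair

variable {P : Type u} {V H : GroupoidOver P} (M : MatchedPair V H)

theorem left_congr {y y' : H.Arr} {f f' : V.Arr} (hy : y = y') (hf : f = f')
    (h : H.tgt y = V.src f) (h' : H.tgt y' = V.src f') :
    M.left.act y f h = M.left.act y' f' h' := by
  subst hy hf; rfl

theorem right_congr {y y' : H.Arr} {f f' : V.Arr} (hy : y = y') (hf : f = f')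
    (h : H.tgt y = V.src f) (h' : H.tgt y' = V.src f') :
    M.right.act y f h = M.right.act y' f' h' := by
  subst hy hf; rfl

theorem one_left (f : V.Arr) (a : P) (h : a = V.src f) :
    M.left.act (H.one a) f (by simpa using h) = f := by
  subst h
  exact M.left.one_act f

theorem inv_left_left (y : H.Arr) (f : V.Arr) (h : H.tgt y = V.src f) :
    M.left.act (H.inv y) (M.left.act y f h) (by simp) = f := by
  rw [M.left.act_act _ _ _ (by simp) h]
  exact (M.left_congr (H.inv_comp y) rfl _ (by simpa using h)).trans (M.one_left f _ h)

theorem left_inv_left (y : H.Arr) (f : V.Arr) (h : H.src y = V.src f) :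
    M.left.act y (M.left.act (H.inv y) f (by simpa using h)) (by simp) = f := by
  rw [M.left.act_act _ _ _ (by simp) (by simpa using h)]
  exact (M.left_congr (H.comp_inv y) rfl _ (by simpa using h)).trans (M.one_left f _ h)

/-- `(y ▷ f)⁻¹ = (y ◁ f) ▷ f⁻¹`. -/
theorem inv_left (y : H.Arr) (f : V.Arr) (h : H.tgt y = V.src f) :
    V.inv (M.left.act y f h) = M.left.act (M.right.act y f h) (V.inv f) (by simp) := by
  refine (V.eq_inv_of_comp_eq_one (by simp) ?_).symm
  rw [← M.left_comp y f (V.inv f) h (by simp)]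
  exact (M.left_congr rfl (V.comp_inv f) _ (by simpa using h)).trans
    ((M.left_one y _ h).trans (by simp))

/-- `(y ◁ (y⁻¹ ▷ f))⁻¹ = y⁻¹ ◁ f`. -/
theorem inv_right (y : H.Arr) (f : V.Arr) (h : H.src y = V.src f) :
    H.inv (M.right.act y (M.left.act (H.inv y) f (by simpa using h)) (by simp)) =
      M.right.act (H.inv y) f (by simpa using h) := by
  refine (H.eq_inv_of_comp_eq_one (by simp) ?_).symm
  rw [← M.comp_right y (H.inv y) f (by simp) (by simpa using h)]
  refine (M.right_congr (H.comp_inv y) rfl _ (by simpa using h)).trans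
    ((M.one_right f _ h).trans ?_)
  rw [← M.tgt_left, M.left_inv_left _ _ h]

theorem right_right_inv (y : H.Arr) (f : V.Arr) (h : H.tgt y = V.src f) :
    M.right.act (M.right.act y f h) (V.inv f) (by simp) = y := by
  rw [M.right.act_act _ _ _ h (by simp)]
  exact (M.right_congr rfl (V.comp_inv f) _ (by simpa using h)).trans (M.right_one y _ h)

end MatchedPair

/-! ### Half-braidings from structures -/

namespace MatchedPair.Rep

variable {P : Type u} {V H : GroupoidOver P} {M : MatchedPair V H}

/-- The structure on a representation `E` of `(V, H)` that extends it to a representation of the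
double: `loop e` is the component in `H` of the degree of `e` over `V × H^op`, and `vert.act e d`
is the action of `d⁻¹ ∈ V ⊆ V ⋈ H` on `e`. The action of `V` is recorded as a right action, since
then every law below is free of inverses. -/
structure DoubleStructure (E : M.Rep) where
  loop : E.carrier → H.Arr
  vert : RightAction V E.p
  src_loop : ∀ e, H.src (loop e) = E.q e
  tgt_loop : ∀ e, H.tgt (loop e) = E.p e
  loop_act : ∀ y e (h : H.tgt y = E.p e),
    H.comp (loop (E.action.act y e h)) y ((tgt_loop _).trans (E.action.p_act _ _ _)) =
      H.comp (M.right.act y (E.deg e) (h.trans (E.p_eq e))) (loop e)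
        ((M.right.q_act _ _ _).trans ((E.q_eq e).symm.trans (src_loop e).symm))
  loop_vert : ∀ e d (h : E.p e = V.src d),
    loop (vert.act e d h) = M.right.act (loop e) d ((tgt_loop e).trans h)
  deg_vert : ∀ e d (h : E.p e = V.src d),
    V.comp d (E.deg (vert.act e d h)) ((vert.q_act e d h).symm.trans (E.p_eq _)) =
      V.comp (E.deg e) (M.left.act (loop e) d ((tgt_loop e).trans h))
        ((E.q_eq e).symm.trans ((src_loop e).symm.trans (M.left.p_act _ _ _).symm))
  act_vert : ∀ y e d (h : H.tgt y = E.p e) (h' : E.p e = V.src d),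
    E.action.act (M.right.act y d (h.trans h')) (vert.act e d h')
        ((M.right.q_act _ _ _).trans (vert.q_act e d h').symm) =
      vert.act (E.action.act y e h) (M.left.act y d (h.trans h'))
        ((E.action.p_act _ _ _).trans (M.left.p_act _ _ _).symm)

theorem inv_act_act (U : M.Rep) (y : H.Arr) (e : U.carrier) (h : H.tgt y = U.p e) :
    U.action.act (H.inv y) (U.action.act y e h) (by simp [U.action.p_act]) = e := by
  rw [U.action.act_act _ _ _ (by simp) h]
  exact (U.act_congr ((H.inv_comp y).trans (congrArg H.one h)) rfl _ (by simp)).trans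
    (U.action.one_act e)

theorem act_inv_act (U : M.Rep) (y : H.Arr) (e : U.carrier) (h : H.src y = U.p e) :
    U.action.act y (U.action.act (H.inv y) e (by simpa using h)) (by simp [U.action.p_act]) =
      e := by
  rw [U.action.act_act _ _ _ (by simp) (by simpa using h)]
  exact (U.act_congr ((H.comp_inv y).trans (congrArg H.one h)) rfl _ (by simp)).trans
    (U.action.one_act e)

namespace DoubleStructure

variable {E : M.Rep} (S : E.DoubleStructure)

theorem vert_congr {e e' : E.carrier} {d d' : V.Arr} (he : e = e') (hd : d = d')
    (h : E.p e = V.src d) (h' : E.p e' = V.src d') :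
    S.vert.act e d h = S.vert.act e' d' h' := by
  subst he hd; rfl

theorem vert_vert_of_comp_eq_one (e : E.carrier) (d d' : V.Arr) (h : E.p e = V.src d)
    (h' : V.tgt d = V.src d') (hd : V.comp d d' h' = V.one (V.src d)) :
    S.vert.act (S.vert.act e d h) d' ((S.vert.q_act _ _ _).trans h') = e := by
  rw [S.vert.act_act _ _ _ h h']
  exact (S.vert_congr rfl (hd.trans (congrArg V.one h.symm)) _ (by simp)).trans (S.vert.act_one e)

theorem q_vert (e : E.carrier) (d : V.Arr) (h : E.p e = V.src d) :
    E.q (S.vert.act e d h) = V.tgt (M.left.act (S.loop e) d ((S.tgt_loop e).trans h)) := by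
  rw [← S.src_loop, S.loop_vert, M.tgt_left]

/-- The half-braiding map `E ⊗ U → U ⊗ E`, which sends `(e, u)` to `(x⁻¹ ▷ u, d⁻¹ ▷ e)`, where
`x` is the loop of `e` and `d = |x⁻¹ ▷ u|`. -/
def braid (U : M.Rep) : E.tensor U ⟶ U.tensor E where
  toFun a := ⟨(U.action.act (H.inv (S.loop a.1.1)) a.1.2 (by rw [H.tgt_inv, S.src_loop, a.2]),
      S.vert.act a.1.1 (U.deg (U.action.act (H.inv (S.loop a.1.1)) a.1.2
          (by rw [H.tgt_inv, S.src_loop, a.2])))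
        (by rw [← U.p_eq, U.action.p_act, H.src_inv, S.tgt_loop])), by
      rw [S.vert.q_act, U.q_eq]⟩
  p_toFun a := by
    change U.p (U.action.act _ _ _) = E.p _
    rw [U.action.p_act, H.src_inv, S.tgt_loop]
  q_toFun a := by
    change E.q (S.vert.act _ _ _) = U.q _
    rw [S.q_vert]
    simp only [U.deg_act]
    rw [M.left_inv_left _ _ (by rw [S.src_loop, a.2, U.p_eq]), U.q_eq]
  deg_toFun a := by
    refine (S.deg_vert _ _ _).trans (V.comp_congr rfl ?_ _ _)
    simp only [U.deg_act]
    exact M.left_inv_left _ _ (by rw [S.src_loop, a.2, U.p_eq])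
  act_toFun y a h := by
    have h : H.tgt y = E.p a.1.1 := h
    have key : U.action.act (H.inv (S.loop (E.action.act y a.1.1 h)))
        (U.action.act (M.right.act y (E.deg a.1.1) (h.trans (E.p_eq _))) a.1.2
          (by rw [tgt_right, ← E.q_eq, a.2])) (by
            rw [H.tgt_inv, S.src_loop, Rep.q_act, U.action.p_act]) =
        U.action.act y (U.action.act (H.inv (S.loop a.1.1)) a.1.2
          (by rw [H.tgt_inv, S.src_loop, a.2])) (by
            rw [U.action.p_act, H.src_inv, S.tgt_loop, h]) := by
      rw [U.action.act_act _ _ _ (by rw [H.tgt_inv, S.src_loop, Rep.q_act])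
        (by rw [tgt_right, ← E.q_eq, a.2]),
        U.action.act_act _ _ _ (by rw [H.src_inv, S.tgt_loop, h])
          (by rw [H.tgt_inv, S.src_loop, a.2])]
      refine U.act_congr ?_ rfl _ _
      refine H.comp_left_cancel (f := S.loop (E.action.act y a.1.1 h)) (by simp)
        (by simp [S.tgt_loop, E.action.p_act]) ?_
      rw [H.comp_inv_cancel _ _ (by rw [S.src_loop, Rep.q_act]),
        ← H.comp_assoc _ _ _ (by simp [S.tgt_loop, E.action.p_act])
          (by rw [H.src_inv, S.tgt_loop, h])]
      have e1 := S.loop_act y a.1.1 h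
      refine Eq.trans ?_ (H.comp_congr e1.symm rfl (by simp) _)
      rw [H.comp_assoc _ _ _ (by simp [S.src_loop, E.q_eq]) (by simp)]
      have e2 := H.comp_one (M.right.act y (E.deg a.1.1) (h.trans (E.p_eq _)))
      refine e2.symm.trans (H.comp_congr rfl ?_ _ (by simp [S.src_loop, E.q_eq]))
      simp [S.src_loop, E.q_eq]
    apply Subtype.ext
    refine Prod.ext key ?_
    refine (S.vert_congr rfl (congrArg U.deg key) _ (by
      rw [← U.p_eq, U.action.p_act]; exact E.action.p_act _ _ _)).trans ?_
    refine Eq.trans ?_ (S.act_vert _ _ _ h _).symm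
    exact S.vert_congr rfl (U.deg_act _ _ _) _ _

theorem braid_fst (U : M.Rep) (e : E.carrier) (u : U.carrier) (h : E.q e = U.p u) :
    ((S.braid U).toFun ⟨(e, u), h⟩).1.1 =
      U.action.act (H.inv (S.loop e)) u (by rw [H.tgt_inv, S.src_loop, h]) :=
  rfl

/-- The half-braiding map is bijective, with inverse `(u, e) ↦ (d ▷ e, x ▷ u)`, where `d = |u|` and
`x` is the loop of `d ▷ e`. -/
def braidIso (U : M.Rep) : E.tensor U ≅ U.tensor E :=
  isoOfInverse (S.braid U)
    (fun a => ⟨(S.vert.act a.1.2 (V.inv (U.deg a.1.1)) (by rw [V.src_inv, ← U.q_eq, a.2]),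
        U.action.act (S.loop (S.vert.act a.1.2 (V.inv (U.deg a.1.1))
          (by rw [V.src_inv, ← U.q_eq, a.2]))) a.1.1
          (by rw [S.tgt_loop, S.vert.q_act, V.tgt_inv, U.p_eq])),
      by rw [U.action.p_act, S.src_loop]⟩)
    (by
      rintro ⟨⟨e, u⟩, h⟩
      have h : E.q e = U.p u := h
      have key : S.vert.act ((S.braid U).toFun ⟨(e, u), h⟩).1.2
          (V.inv (U.deg ((S.braid U).toFun ⟨(e, u), h⟩).1.1))
            (by rw [V.src_inv, ← U.q_eq, ((S.braid U).toFun ⟨(e, u), h⟩).2]) = e :=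
        S.vert_vert_of_comp_eq_one _ _ _ _ (V.src_inv _).symm (V.comp_inv _)
      apply Subtype.ext
      refine Prod.ext key ?_
      exact (U.act_congr (congrArg S.loop key) rfl _ (by
        rw [S.tgt_loop, S.braid_fst, U.action.p_act, H.src_inv, S.tgt_loop])).trans
          (U.act_inv_act _ _ (by rw [S.src_loop, h])))
    (by
      rintro ⟨⟨u, e⟩, h⟩
      have h : U.q u = E.p e := h
      have key := U.inv_act_act (S.loop (S.vert.act e (V.inv (U.deg u))
          (by rw [V.src_inv, ← U.q_eq, h]))) u
          (by rw [S.tgt_loop, S.vert.q_act, V.tgt_inv, U.p_eq])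
      apply Subtype.ext
      refine Prod.ext key ?_
      refine (S.vert_congr rfl (congrArg U.deg key) _ (by
        rw [S.vert.q_act, V.tgt_inv])).trans ?_
      exact S.vert_vert_of_comp_eq_one _ _ _ _ (by simp) (by simp))

/-- The half-braiding on `E` given by the structure of a representation of the double. -/
def halfBraiding : HalfBraiding E where
  β := S.braidIso
  monoidal U U' := by
    apply hom_ext
    rintro ⟨⟨e, ⟨⟨u, u'⟩, h'⟩⟩, h⟩
    have h : E.q e = U.p u := h
    have h' : U.q u = U'.p u' := h'
    have hu : H.tgt (H.inv (S.loop e)) = U.p u := by rw [H.tgt_inv, S.src_loop, h]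
    have he : E.p e = V.src (U.deg (U.action.act (H.inv (S.loop e)) u hu)) := by
      rw [← U.p_eq, U.action.p_act, H.src_inv, S.tgt_loop]
    have hu' : H.tgt (H.inv (S.loop (S.vert.act e _ he))) = U'.p u' := by
      rw [H.tgt_inv, S.src_loop, S.q_vert]
      simp only [U.deg_act]
      rw [M.left_inv_left _ _ (by rw [S.src_loop, h, U.p_eq]), ← U.q_eq, h']
    have key : U'.action.act (M.right.act (H.inv (S.loop e)) (U.deg u) (hu.trans (U.p_eq u))) u'
        (by rw [tgt_right, ← U.q_eq, h']) =
      U'.action.act (H.inv (S.loop (S.vert.act e _ he))) u' hu' := by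
      refine U'.act_congr ?_ rfl _ _
      rw [S.loop_vert]
      simp only [U.deg_act]
      exact (M.inv_right _ _ (by rw [S.src_loop, h, U.p_eq])).symm
    have hd : V.tgt (U.deg (U.action.act (H.inv (S.loop e)) u hu)) =
        V.src (U'.deg (U'.action.act (H.inv (S.loop (S.vert.act e _ he))) u' hu')) := by
      rw [← U'.p_eq, U'.action.p_act, H.src_inv, S.tgt_loop, S.vert.q_act]
    apply Subtype.ext
    refine Prod.ext (Subtype.ext (Prod.ext rfl key)) ?_
    refine Eq.trans ?_ (S.vert.act_act e _ _ he hd).symm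
    exact S.vert_congr rfl (V.comp_congr rfl (congrArg U'.deg key) _ _) _ _
  naturality f := by
    apply hom_ext
    rintro ⟨⟨e, u⟩, h⟩
    have h : E.q e = _ := h
    have key := f.act_toFun (H.inv (S.loop e)) u (by rw [H.tgt_inv, S.src_loop, h])
    apply Subtype.ext
    refine Prod.ext key.symm ?_
    exact S.vert_congr rfl ((congrArg _ key.symm).trans (f.deg_toFun _)) _ _

end DoubleStructure

end MatchedPair.Rep

/-! ### Structures from half-braidings -/

namespace MatchedPair.Rep

variable {P : Type u} {V H : GroupoidOver P} {M : MatchedPair V H}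

variable (M) in
/-- The free representation generated by one element of degree `g`: its elements are the arrows
`h` of `H` that end at the source of `g`, and `h` has degree `h ▷ g`. -/
def free (g : V.Arr) : M.Rep where
  carrier := {h : H.Arr // H.tgt h = V.src g}
  p h := H.src h.1
  q h := V.tgt (M.left.act h.1 g h.2)
  action :=
    { act := fun x h hx => ⟨H.comp x h.1 hx, (H.tgt_comp _ _ _).trans h.2⟩
      p_act := fun _ _ _ => H.src_comp _ _ _
      act_act := fun _ _ _ hx hy => Subtype.ext (H.comp_assoc _ _ _ hx hy).symm
      one_act := fun h => Subtype.ext (H.one_comp h.1) }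
  deg h := M.left.act h.1 g h.2
  p_eq _ := (M.left.p_act _ _ _).symm
  q_eq _ := rfl
  deg_act _ h hx := (M.left.act_act _ _ _ hx h.2).symm

variable (M) in
/-- The generator of the free representation. -/
def freeGen (g : V.Arr) : (free M g).carrier := ⟨H.one (V.src g), H.tgt_one _⟩

theorem p_freeGen (g : V.Arr) : (free M g).p (freeGen M g) = V.src g := H.src_one _

theorem deg_freeGen (g : V.Arr) : (free M g).deg (freeGen M g) = g := M.left.one_act g

/-- The morphism from the free representation that sends the generator to `u`. -/
def freeHom (U : M.Rep) (u : U.carrier) : free M (U.deg u) ⟶ U where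
  toFun h := U.action.act h.1 u (h.2.trans (U.p_eq u).symm)
  p_toFun _ := U.action.p_act _ _ _
  q_toFun h := by rw [U.q_eq, U.deg_act]; rfl
  deg_toFun _ := U.deg_act _ _ _
  act_toFun _ _ hx := (U.action.act_act _ _ _ hx _).symm

theorem congr_hom {E F : M.Rep} {f g : E ⟶ F} (h : f = g) (e : E.carrier) :
    f.toFun e = g.toFun e := by
  rw [h]

theorem freeHom_freeGen (U : M.Rep) (u : U.carrier) :
    (freeHom U u).toFun (freeGen M (U.deg u)) = u :=
  (U.act_congr (congrArg H.one (U.p_eq u).symm) rfl _ (H.tgt_one _)).trans (U.action.one_act u)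

namespace HalfBraiding

variable {E : M.Rep} (b : HalfBraiding E)

/-- The value of a half-braiding on a pair `(e, u)`. -/
def app (U : M.Rep) (e : E.carrier) (u : U.carrier) (h : E.q e = U.p u) :
    (U.tensor E).carrier :=
  (b.β U).hom.toFun ⟨(e, u), h⟩

theorem p_app (U : M.Rep) (e : E.carrier) (u : U.carrier) (h : E.q e = U.p u) :
    U.p (app b U e u h).1.1 = E.p e :=
  (b.β U).hom.p_toFun _

theorem app_congr {U : M.Rep} {e e' : E.carrier} {u u' : U.carrier} (he : e = e') (hu : u = u')
    (h : E.q e = U.p u) (h' : E.q e' = U.p u') : app b U e u h = app b U e' u' h' := by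
  subst he hu; rfl

/-- The arrow `x` of `H` such that a half-braiding sends `(e, u)`, for the generator `u` of degree
`g`, to a pair with first component `x ▷ u`. -/
def arrow (e : E.carrier) (g : V.Arr) (h : E.q e = V.src g) : H.Arr :=
  (app b (free M g) e (freeGen M g) (h.trans (p_freeGen g).symm)).1.1.1

/-- The second component of the value of a half-braiding on `(e, u)`, for the generator `u` of
degree `g`. -/
def shift (e : E.carrier) (g : V.Arr) (h : E.q e = V.src g) : E.carrier :=
  (app b (free M g) e (freeGen M g) (h.trans (p_freeGen g).symm)).1.2

theorem arrow_congr {e e' : E.carrier} {g g' : V.Arr} (he : e = e') (hg : g = g')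
    (h : E.q e = V.src g) (h' : E.q e' = V.src g') : arrow b e g h = arrow b e' g' h' := by
  subst he hg; rfl

theorem shift_congr {e e' : E.carrier} {g g' : V.Arr} (he : e = e') (hg : g = g')
    (h : E.q e = V.src g) (h' : E.q e' = V.src g') : shift b e g h = shift b e' g' h' := by
  subst he hg; rfl

theorem src_arrow (e : E.carrier) (g : V.Arr) (h : E.q e = V.src g) :
    H.src (arrow b e g h) = E.p e :=
  (b.β (free M g)).hom.p_toFun _

theorem tgt_arrow (e : E.carrier) (g : V.Arr) (h : E.q e = V.src g) :
    H.tgt (arrow b e g h) = V.src g :=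
  (app b (free M g) e (freeGen M g) (h.trans (p_freeGen g).symm)).1.1.2

theorem p_shift (e : E.carrier) (g : V.Arr) (h : E.q e = V.src g) :
    E.p (shift b e g h) = V.tgt (M.left.act (arrow b e g h) g (tgt_arrow b e g h)) :=
  (app b (free M g) e (freeGen M g) (h.trans (p_freeGen g).symm)).2.symm

theorem q_shift (e : E.carrier) (g : V.Arr) (h : E.q e = V.src g) :
    E.q (shift b e g h) = V.tgt g :=
  ((b.β (free M g)).hom.q_toFun _).trans (congrArg V.tgt (deg_freeGen g))

theorem deg_shift (e : E.carrier) (g : V.Arr) (h : E.q e = V.src g) :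
    V.comp (M.left.act (arrow b e g h) g (tgt_arrow b e g h)) (E.deg (shift b e g h))
        ((p_shift b e g h).symm.trans (E.p_eq _)) =
      V.comp (E.deg e) g ((E.q_eq e).symm.trans h) :=
  ((b.β (free M g)).hom.deg_toFun _).trans (V.comp_congr rfl (deg_freeGen g) _ _)

/-- By naturality, a half-braiding is determined by its values on the generators of the free
representations. -/
theorem app_eq (U : M.Rep) (e : E.carrier) (u : U.carrier) (h : E.q e = U.p u) :
    (app b U e u h).1 =
      (U.action.act (arrow b e (U.deg u) (h.trans (U.p_eq u))) u
          ((tgt_arrow b _ _ _).trans (U.p_eq u).symm),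
        shift b e (U.deg u) (h.trans (U.p_eq u))) := by
  have n := congr_hom (b.naturality (freeHom U u))
    ⟨(e, freeGen M (U.deg u)), (h.trans (U.p_eq u)).trans (p_freeGen _).symm⟩
  exact (congrArg Subtype.val (app_congr b rfl (freeHom_freeGen U u).symm h
    (by rw [freeHom_freeGen, h]))).trans (congrArg Subtype.val n)

/-- The hexagon axiom, on elements. -/
theorem app_tensor (U U' : M.Rep) (e : E.carrier) (u : U.carrier) (u' : U'.carrier)
    (h : E.q e = U.p u) (h' : U.q u = U'.p u') (h'' : E.q (app b U e u h).1.2 = U'.p u') :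
    (app b (U.tensor U') e ⟨(u, u'), h'⟩ h).1 =
      (⟨((app b U e u h).1.1, (app b U' (app b U e u h).1.2 u' h'').1.1),
          (app b U e u h).2.trans (p_app b U' _ u' h'').symm⟩,
        (app b U' (app b U e u h).1.2 u' h'').1.2) :=
  congrArg Subtype.val (congr_hom (b.monoidal U U')
    (⟨(e, ⟨(u, u'), h'⟩), h⟩ : (E.tensor (U.tensor U')).carrier))

section Tensor

variable (e : E.carrier) (g g' : V.Arr) (h : E.q e = V.src g) (h' : V.tgt g = V.src g')

/-- The hexagon axiom for the pair of generators of degrees `g` and `g'`, compared with naturality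
(`app_eq`): its three components. -/
theorem app_freeGen_tensor :
    H.comp (arrow b e (V.comp g g' h') (by simpa using h)) (H.one (V.src g))
        (by simp [tgt_arrow]) = arrow b e g h ∧
    H.comp (M.right.act (arrow b e (V.comp g g' h') (by simpa using h)) g (by simp [tgt_arrow]))
        (H.one (V.src g')) (by simp [h']) =
      arrow b (shift b e g h) g' ((q_shift b e g h).trans h') ∧
    shift b e (V.comp g g' h') (by simpa using h) =
      shift b (shift b e g h) g' ((q_shift b e g h).trans h') := by
  have hq : (free M g).q (freeGen M g) = (free M g').p (freeGen M g') := by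
    rw [p_freeGen g', (free M g).q_eq, deg_freeGen g, h']
  have e1 := app_tensor b (free M g) (free M g') e (freeGen M g) (freeGen M g')
    (h.trans (p_freeGen (M := M) g).symm) hq
    (((q_shift b e g h).trans h').trans (p_freeGen (M := M) g').symm)
  have e2 := app_eq b ((free M g).tensor (free M g')) e ⟨(freeGen M g, freeGen M g'), hq⟩
    (h.trans (p_freeGen (M := M) g).symm)
  have hd : ((free M g).tensor (free M g')).deg ⟨(freeGen M g, freeGen M g'), hq⟩ =
      V.comp g g' h' := V.comp_congr (deg_freeGen g) (deg_freeGen g') _ _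
  have e3 := e2.symm.trans e1
  have e4 := congrArg (fun a => a.1.1.1.1) e3
  have e5 := congrArg (fun a => a.1.1.2.1) e3
  have e6 := congrArg Prod.snd e3
  refine ⟨Eq.trans ?_ e4, Eq.trans ?_ e5, Eq.trans ?_ e6⟩
  · exact H.comp_congr (arrow_congr b rfl hd.symm _ _) rfl _ _
  · exact H.comp_congr (M.right_congr (arrow_congr b rfl hd.symm _ _) (deg_freeGen g).symm _
      (by rw [tgt_arrow, hd, deg_freeGen g, V.src_comp])) rfl _ _
  · exact shift_congr b rfl hd.symm _ (by rw [hd, V.src_comp, h])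

theorem arrow_comp : arrow b e (V.comp g g' h') (by simpa using h) = arrow b e g h := by
  refine Eq.trans ?_ (app_freeGen_tensor b e g g' h h').1
  refine (H.comp_one _).symm.trans (H.comp_congr rfl ?_ _ _)
  simp [tgt_arrow]

theorem shift_shift : shift b (shift b e g h) g' ((q_shift b e g h).trans h') =
    shift b e (V.comp g g' h') (by simpa using h) :=
  (app_freeGen_tensor b e g g' h h').2.2.symm

/-- The arrow of a half-braiding depends on `e` alone. -/
theorem arrow_eq_arrow_one : arrow b e g h = arrow b e (V.one (E.q e)) (V.src_one _).symm := by
  rw [← arrow_comp b e (V.one (E.q e)) g (V.src_one _).symm ((V.tgt_one _).trans h)]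
  refine arrow_congr b rfl ?_ _ _
  exact (V.one_comp g).symm.trans (V.comp_congr (congrArg V.one h.symm) rfl _ _)

end Tensor

theorem arrow_shift (e : E.carrier) (g : V.Arr) (h : E.q e = V.src g) (g' : V.Arr)
    (h' : E.q (shift b e g h) = V.src g') : arrow b (shift b e g h) g' h' =
      M.right.act (arrow b e g h) g (tgt_arrow b e g h) := by
  have ht : V.tgt g = V.src g' := (q_shift b e g h).symm.trans h'
  refine (app_freeGen_tensor b e g g' h ht).2.1.symm.trans ?_
  refine Eq.trans ?_ (M.right_congr (arrow_comp b e g g' h ht) rfl (by simp [tgt_arrow]) _)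
  refine Eq.trans (H.comp_congr rfl ?_ _ _) (H.comp_one _)
  simp [ht]

/-- A half-braiding is normalized on generators of identity degree. Since the shift by an identity
is idempotent and keeps the arrow, this follows from injectivity of the half-braiding. -/
theorem shift_one (e : E.carrier) : shift b e (V.one (E.q e)) (V.src_one _).symm = e := by
  have hq : E.q (shift b e (V.one (E.q e)) (V.src_one _).symm) = V.src (V.one (E.q e)) := by
    rw [q_shift]; simp
  have h1 : shift b (shift b e (V.one (E.q e)) (V.src_one _).symm) (V.one (E.q e)) hq =
      shift b e (V.one (E.q e)) (V.src_one _).symm := by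
    rw [shift_shift b e _ _ (V.src_one _).symm (by simp)]
    refine shift_congr b rfl ?_ _ _
    exact (V.comp_congr rfl (by simp) _ _).trans (V.comp_one _)
  have h2 : arrow b (shift b e (V.one (E.q e)) (V.src_one _).symm) (V.one (E.q e)) hq =
      arrow b e (V.one (E.q e)) (V.src_one _).symm := by
    rw [arrow_shift, M.right_one _ _ ((tgt_arrow b _ _ _).trans (V.src_one _))]
  -- `e` and its shift have the same image under the half-braiding.
  have inj : Function.Injective (b.β (free M (V.one (E.q e)))).hom.toFun := by
    refine Function.LeftInverse.injective (g := (b.β (free M (V.one (E.q e)))).inv.toFun) ?_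
    intro a
    exact congr_hom (b.β (free M (V.one (E.q e)))).hom_inv_id a
  have := @inj ⟨(_, freeGen M (V.one (E.q e))), hq.trans (p_freeGen _).symm⟩
    ⟨(e, freeGen M (V.one (E.q e))), (V.src_one _).symm.trans (p_freeGen _).symm⟩
    (Subtype.ext (Prod.ext (Subtype.ext h2) h1))
  exact congrArg (fun a => a.1.1) this

section Act

variable (y : H.Arr) (e : E.carrier) (g : V.Arr) (hy : H.tgt y = E.p e) (h : E.q e = V.src g)

/-- Equivariance of a half-braiding at `(e, u)`, for the generator `u` of degree `g`: both
components. -/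
theorem app_act_freeGen :
    H.comp (arrow b (E.action.act y e hy)
          (M.left.act (M.right.act y (E.deg e) (hy.trans (E.p_eq e))) g
            (by rw [tgt_right, ← E.q_eq, h])) (by simp))
        (M.right.act y (E.deg e) (hy.trans (E.p_eq e))) (by simp [tgt_arrow]) =
      H.comp y (arrow b e g h) (by rw [src_arrow, hy]) ∧
    shift b (E.action.act y e hy)
        (M.left.act (M.right.act y (E.deg e) (hy.trans (E.p_eq e))) g
          (by rw [tgt_right, ← E.q_eq, h])) (by simp) =
      E.action.act (M.right.act y (M.left.act (arrow b e g h) g (tgt_arrow b e g h))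
        (by simp [src_arrow, hy])) (shift b e g h) (by simp [p_shift]) := by
  have hu : H.tgt (M.right.act y (E.deg e) (hy.trans (E.p_eq e))) =
      (free M g).p (freeGen M g) := by
    rw [tgt_right, ← E.q_eq, h, p_freeGen]
  have e1 := congrArg Subtype.val ((b.β (free M g)).hom.act_toFun y
    ⟨(e, freeGen M g), h.trans (p_freeGen g).symm⟩ hy)
  have e2 := app_eq b (free M g) (E.action.act y e hy)
    ((free M g).action.act (M.right.act y (E.deg e) (hy.trans (E.p_eq e))) (freeGen M g) hu)
    (by rw [Rep.q_act, (free M g).action.p_act])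
  have e3 := e2.symm.trans e1
  have hd : (free M g).deg ((free M g).action.act
      (M.right.act y (E.deg e) (hy.trans (E.p_eq e))) (freeGen M g) hu) =
      M.left.act (M.right.act y (E.deg e) (hy.trans (E.p_eq e))) g
        (by rw [tgt_right, ← E.q_eq, h]) :=
    ((free M g).deg_act _ _ _).trans (M.left_congr rfl (deg_freeGen g) _ _)
  refine ⟨Eq.trans ?_ (congrArg (fun a => a.1.1) e3), Eq.trans ?_ (congrArg Prod.snd e3)⟩
  · refine H.comp_congr (arrow_congr b rfl hd.symm _ _) ?_ _ _
    refine (H.comp_one _).symm.trans (H.comp_congr rfl ?_ _ _)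
    rw [tgt_right, ← E.q_eq, h]
    rfl
  · exact shift_congr b rfl hd.symm _ (by rw [hd, Rep.q_act, src_left])

end Act

/-- The arrow `x` of `H` such that a half-braiding sends `(e, u)` to a pair with first component
`x⁻¹ ▷ u`. -/
def loopArr (e : E.carrier) : H.Arr := H.inv (arrow b e (V.one (E.q e)) (V.src_one _).symm)

theorem src_loopArr (e : E.carrier) : H.src (loopArr b e) = E.q e := by
  simp [loopArr, tgt_arrow]

theorem tgt_loopArr (e : E.carrier) : H.tgt (loopArr b e) = E.p e := by
  simp [loopArr, src_arrow]

theorem arrow_eq (e : E.carrier) (g : V.Arr) (h : E.q e = V.src g) :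
    arrow b e g h = H.inv (loopArr b e) := by
  rw [loopArr, H.inv_inv, arrow_eq_arrow_one]

/-- For `g = x ▷ d`, with `x` the loop of `e`, the arrow `x⁻¹` of the half-braiding gives back
`d`. Hence the shift by `g` moves `e` along `d`, which turns shifts into an action of `V` on `p`. -/
theorem left_arrow (e : E.carrier) (d g : V.Arr) (h : E.p e = V.src d)
    (hg : g = M.left.act (loopArr b e) d ((tgt_loopArr b e).trans h)) (hs : E.q e = V.src g) :
    M.left.act (arrow b e g hs) g (tgt_arrow b e g hs) = d := by
  subst hg
  exact (M.left_congr (arrow_eq b _ _ _) rfl _ (by simp)).trans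
    (M.inv_left_left _ _ ((tgt_loopArr b e).trans h))

theorem loopArr_shift (e : E.carrier) (d : V.Arr) (h : E.p e = V.src d) :
    loopArr b (shift b e (M.left.act (loopArr b e) d ((tgt_loopArr b e).trans h))
        (by simp [src_loopArr])) = M.right.act (loopArr b e) d ((tgt_loopArr b e).trans h) := by
  have hs := (tgt_loopArr b e).trans h
  have key : M.right.act (arrow b e (M.left.act (loopArr b e) d hs) (by simp [src_loopArr]))
      (M.left.act (loopArr b e) d hs) (tgt_arrow b e _ _) =
      H.inv (M.right.act (loopArr b e) d hs) := by
    refine (M.right_congr (arrow_eq b _ _ _) rfl _ (by simp)).trans ?_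
    refine (M.inv_right _ _ (by simp)).symm.trans ?_
    exact congrArg H.inv (M.right_congr rfl (M.inv_left_left _ _ hs) _ _)
  rw [← H.inv_inv (M.right.act _ _ _), ← key]
  exact congrArg H.inv (arrow_shift b _ _ _ _ _)

theorem loopArr_act (y : H.Arr) (e : E.carrier) (h : H.tgt y = E.p e) :
    H.comp (loopArr b (E.action.act y e h)) y
        ((tgt_loopArr b _).trans (E.action.p_act _ _ _)) =
      H.comp (M.right.act y (E.deg e) (h.trans (E.p_eq e))) (loopArr b e)
        ((M.right.q_act _ _ _).trans ((E.q_eq e).symm.trans (src_loopArr b e).symm)) := by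
  apply H.comp_eq_comp_of_inv_comp
  · refine Eq.trans ?_ ((app_act_freeGen b y e (V.one (E.q e)) h (V.src_one _).symm).1.trans ?_)
    · exact H.comp_congr (arrow_eq b _ _ _).symm rfl _ _
    · exact H.comp_congr rfl (arrow_eq b _ _ _) _ (by simp [tgt_loopArr, h])
  · simp [src_loopArr, E.q_eq, E.deg_act]
  · simp [tgt_loopArr, h]

/-- The structure of a representation of the double that a half-braiding defines. -/
def doubleStructure : E.DoubleStructure where
  loop := loopArr b
  vert :=
    { act := fun e d h => shift b e (M.left.act (loopArr b e) d ((tgt_loopArr b e).trans h))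
        (by simp [src_loopArr])
      q_act := fun e d h => by
        rw [p_shift, left_arrow b e d _ h rfl]
      act_act := fun e d d' h h' => by
        have hd : V.tgt (M.left.act (loopArr b e) d ((tgt_loopArr b e).trans h)) =
            V.src (M.left.act (M.right.act (loopArr b e) d ((tgt_loopArr b e).trans h)) d'
              (by simp [h'])) := by simp
        refine Eq.trans ?_ ((shift_shift b e _ _ (by simp [src_loopArr]) hd).trans ?_)
        · exact shift_congr b rfl (M.left_congr (loopArr_shift b e d h) rfl _ _) _ _
        · exact shift_congr b rfl (M.left_comp _ _ _ ((tgt_loopArr b e).trans h) h').symm _ _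
      act_one := fun e => by
        refine Eq.trans ?_ (shift_one b e)
        exact shift_congr b rfl ((M.left_one _ _ (tgt_loopArr b e)).trans
          (by rw [src_loopArr])) _ _ }
  src_loop := src_loopArr b
  tgt_loop := tgt_loopArr b
  loop_act := loopArr_act b
  loop_vert := loopArr_shift b
  deg_vert e d h := by
    refine Eq.trans ?_ (deg_shift b e (M.left.act (loopArr b e) d ((tgt_loopArr b e).trans h))
      (by simp [src_loopArr]))
    exact V.comp_congr (left_arrow b e d _ h rfl _).symm rfl _ _
  act_vert y e d h h' := by
    have hs := (tgt_loopArr b e).trans h'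
    refine Eq.trans ?_ ((app_act_freeGen b y e (M.left.act (loopArr b e) d hs) h
      (by simp [src_loopArr])).2.symm.trans ?_)
    · exact E.act_congr (M.right_congr rfl (left_arrow b e d _ h' rfl _).symm _ _) rfl _ _
    · refine shift_congr b rfl ?_ _ (by rw [M.src_left, src_loopArr])
      refine (M.left.act_act _ _ _ (by simp [src_loopArr, E.q_eq]) hs).trans ?_
      refine (M.left_congr (loopArr_act b y e h).symm rfl _ (by simp [h, h'])).trans ?_
      exact (M.left.act_act _ _ _ (by simp [tgt_loopArr, E.action.p_act]) (h.trans h')).symm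

end HalfBraiding

end MatchedPair.Rep

/-! ### Representations of the double -/

namespace MatchedPair

variable {P : Type u} {V H : GroupoidOver P} (M : MatchedPair V H)

theorem omega_one (a : P) (γ : V.Arr) (x : H.Arr) (h : a = V.src γ) (hx : V.src γ = H.tgt x)
    (hx' : V.tgt γ = H.src x) : M.omega (H.one a) γ x (by simpa using h) hx hx' = x := by
  have e1 : H.comp (M.right.act (H.one a) γ (by simpa using h)) x (by simp [hx']) = x :=
    (H.comp_congr (M.one_right γ a h) rfl _ (by simp [hx'])).trans (H.one_comp_of_eq x _ hx')
  exact (H.comp_congr e1 (H.inv_one a) _ (by simp [h, hx])).trans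
    (H.comp_one_of_eq x a (by rw [h, hx]))

section DoubleAction

variable (s : M.doubleV.Arr)

theorem fstArr_dLeft_inclH (y : H.Arr) (h : H.tgt y = V.src (M.fstArr s)) :
    M.fstArr (M.dLeft (M.inclH y) s h) = M.left.act y (M.fstArr s) h := by
  refine (V.comp_congr (V.one_comp_of_eq _ _ (M.src_left _ _ _).symm)
    ((M.left_congr rfl (V.inv_one (H.src y)) _ (by simp [inclH])).trans
      (M.left_one _ _ (by simp [inclH]))) _ (by simp [inclH])).trans (V.comp_one_of_eq _ _ ?_)
  simp [inclH]

theorem sndArr_dLeft_inclH (y : H.Arr) (h : H.tgt y = V.src (M.fstArr s)) :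
    M.sndArr (M.dLeft (M.inclH y) s h) =
      M.omega y (M.fstArr s) (M.sndArr s) h (M.src_eq s) (M.tgt_eq s) :=
  (M.right_congr rfl (V.inv_one (H.src y)) _ (by simp [inclH])).trans
    (M.right_one _ _ (by simp [inclH]))

theorem sndArr_dLeft_inclV (g : V.Arr) (h : V.tgt g = V.src (M.fstArr s)) :
    M.sndArr (M.dLeft (M.inclV g) s ((M.tgt_inclV g).trans h)) =
      M.right.act (M.sndArr s) (V.inv g) (by simp [← M.src_eq, h]) :=
  M.right_congr (M.omega_one _ _ _ h _ _) rfl _ _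

theorem fstArr_dLeft_inclV (g : V.Arr) (h : V.tgt g = V.src (M.fstArr s)) :
    M.fstArr (M.dLeft (M.inclV g) s ((M.tgt_inclV g).trans h)) =
      V.comp (V.comp g (M.fstArr s) h)
        (M.left.act (M.sndArr s) (V.inv g) (by simp [← M.src_eq, h])) (by simp [M.tgt_eq]) :=
  V.comp_congr (V.comp_congr rfl (M.one_left _ _ h) _ _)
    (M.left_congr (M.omega_one _ _ _ h _ _) rfl _ _) _ _

end DoubleAction

theorem inv_comp_doubleLeft_fst (f : V.Arr) (y : H.Arr) (γ : V.Arr) (x : H.Arr)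
    (hf : V.tgt f = H.src y) (hγ : H.tgt y = V.src γ) (hx : V.src γ = H.tgt x)
    (hx' : V.tgt γ = H.src x) :
    V.comp (V.inv f) (M.doubleLeft f y γ x hf hγ hx hx').fst (by simp [doubleLeft]) =
      V.comp (M.left.act y γ hγ)
        (M.left.act (M.omega y γ x hγ hx hx') (V.inv f) (by simp [hf])) (by simp) := by
  simp only [doubleLeft, V.comp_assoc']
  exact V.inv_comp_cancel _ _ (by simp [hf])

/-- The exchange law `(y ◁ d) d⁻¹ = (y ▷ d)⁻¹ y` in the diagonal groupoid. -/
theorem inclH_comp_inclV_inv (y : H.Arr) (d : V.Arr) (h : H.tgt y = V.src d) :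
    M.diagonal.comp (M.inclH (M.right.act y d h)) (M.inclV (V.inv d)) (by simp) =
      M.diagonal.comp (M.inclV (V.inv (M.left.act y d h))) (M.inclH y) (by simp) := by
  rw [← M.cell _ _ (by simp)]
  exact M.diagonal.comp_congr (congrArg M.inclV (M.inv_left y d h).symm)
    (congrArg M.inclH (M.right_right_inv y d h)) _ _

namespace Rep

variable {M}

/-- The representation of `(V, H)` underlying a representation of the double: the action is
restricted along `H ⊆ V ⋈ H`, and the degree is projected from `V × H^op` to `V`. -/
def restrict (E : M.double.Rep) : M.Rep where
  carrier := E.carrier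
  p := E.p
  q := E.q
  action :=
    { act := fun y e h => E.action.act (M.inclH y) e h
      p_act := fun y _ _ => (E.action.p_act _ _ _).trans (M.src_inclH y)
      act_act := fun y y' _ h _ => (E.action.act_act _ _ _ _ _).trans
        (E.act_congr (M.inclH_comp y y' h).symm rfl _ _)
      one_act := fun e => (E.act_congr (M.inclH_one _) rfl _ _).trans (E.action.one_act e) }
  deg e := M.fstArr (E.deg e)
  p_eq := E.p_eq
  q_eq := E.q_eq
  deg_act y e h := (congrArg M.fstArr (E.deg_act (M.inclH y) e h)).trans
    (M.fstArr_dLeft_inclH _ y _)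

/-- The structure that a representation of the double defines on the underlying representation. -/
def restrictStructure (E : M.double.Rep) : (restrict E).DoubleStructure where
  loop e := M.sndArr (E.deg e)
  vert :=
    { act := fun e d h => E.action.act (M.inclV (V.inv d)) e
        ((M.tgt_inclV _).trans ((V.tgt_inv d).trans h.symm))
      q_act := fun e d h => (E.action.p_act _ _ _).trans (V.src_inv d)
      act_act := fun e d d' h h' => by
        refine (E.action.act_act _ _ _ (by simp [h']) _).trans (E.act_congr ?_ rfl _ _)
        rw [V.inv_comp_rev _ _ h', M.inclV_comp]
      act_one := fun e => by
        refine (E.act_congr ?_ rfl _ ?_).trans (E.action.one_act e)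
        · exact (congrArg M.inclV (V.inv_one _)).trans (M.inclV_one _)
        · simp }
  src_loop e := (M.tgt_eq (E.deg e)).symm.trans (E.q_eq e).symm
  tgt_loop e := (M.src_eq (E.deg e)).symm.trans (E.p_eq e).symm
  loop_act y e h := by
    have hp : E.p e = V.src (M.fstArr (E.deg e)) := E.p_eq e
    refine (H.comp_congr ((congrArg M.sndArr (E.deg_act (M.inclH y) e h)).trans
      (M.sndArr_dLeft_inclH _ y (h.trans hp))) rfl _ (by simp)).trans ?_
    exact H.comp_inv_comp _ _ (by simpa [← M.src_eq] using (h.trans hp).symm)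
  loop_vert e d h := by
    have hp : E.p e = V.src (M.fstArr (E.deg e)) := E.p_eq e
    have ht : V.tgt (V.inv d) = V.src (M.fstArr (E.deg e)) := by
      rw [V.tgt_inv, ← hp]
      exact h.symm
    refine (congrArg M.sndArr (E.deg_act (M.inclV (V.inv d)) e _)).trans
      ((M.sndArr_dLeft_inclV _ (V.inv d) ht).trans ?_)
    exact M.right_congr rfl (V.inv_inv d) _ _
  deg_vert e d h := by
    have hp : E.p e = V.src (M.fstArr (E.deg e)) := E.p_eq e
    have ht : V.tgt (V.inv d) = V.src (M.fstArr (E.deg e)) := by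
      rw [V.tgt_inv, ← hp]
      exact h.symm
    refine (V.comp_congr rfl ((congrArg M.fstArr (E.deg_act (M.inclV (V.inv d)) e _)).trans
      (M.fstArr_dLeft_inclV _ (V.inv d) ht)) _ (by simp)).trans ?_
    simp only [V.comp_assoc']
    refine (V.comp_inv_cancel _ _ (by simpa using ht)).trans ?_
    exact V.comp_congr rfl (M.left_congr rfl (V.inv_inv d) _ _) _ _
  act_vert y e d h h' := by
    have h : H.tgt y = E.p e := h
    have h' : E.p e = V.src d := h'
    refine (E.action.act_act _ _ _ (by simp) (by simp [h'])).trans ((E.act_congr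
      (M.inclH_comp_inclV_inv y d (h.trans h')) rfl _ (by simp [h])).trans
      (E.action.act_act _ _ _ (by simp) (by simp [h])).symm)

namespace DoubleStructure

variable {E : M.Rep} (S : E.DoubleStructure)

/-- The law `loop_act`, solved for the loop of `y ▷ e`. -/
theorem loop_act_eq_omega (y : H.Arr) (e : E.carrier) (h : H.tgt y = E.p e) :
    S.loop (E.action.act y e h) = M.omega y (E.deg e) (S.loop e) (h.trans (E.p_eq e))
      ((E.p_eq e).symm.trans (S.tgt_loop e).symm) ((E.q_eq e).symm.trans (S.src_loop e).symm) := by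
  have h1 := H.comp_inv_comp (S.loop (E.action.act y e h)) (H.inv y)
    (by simp [S.tgt_loop, E.action.p_act])
  refine h1.symm.trans (H.comp_congr ?_ rfl _ _)
  exact (H.comp_congr rfl (H.inv_inv y) _ (by simp [S.tgt_loop, E.action.p_act])).trans
    (S.loop_act y e h)

/-- The representation of the double given by a representation `E` of `(V, H)` with the additional
structure. An arrow `(f, y)` of `V ⋈ H` acts by `y` and then by `f`. -/
def toRep : M.double.Rep where
  carrier := E.carrier
  p := E.p
  q := E.q
  action :=
    { act := fun a e h => S.vert.act (E.action.act (DiagArr.snd a) e h) (V.inv (DiagArr.fst a))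
        ((E.action.p_act _ _ _).trans ((DiagArr.comm a).symm.trans (V.src_inv _).symm))
      p_act := fun a e h => (S.vert.q_act _ _ _).trans (V.tgt_inv _)
      act_act := by
        rintro ⟨f, y, hf⟩ ⟨f', y', hf'⟩ e h h'
        have h : H.tgt y = V.src f' := h
        have h' : H.tgt y' = E.p e := h'
        have hf : V.tgt f = H.src y := hf
        have hf' : V.tgt f' = H.src y' := hf'
        -- `y = (y ◁ f') ◁ f'⁻¹` moves past the action of `f'` by the law `act_vert`.
        have k := S.act_vert (M.right.act y f' h) (E.action.act y' e h') (V.inv f')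
          (by rw [M.tgt_right, E.action.p_act, hf']) (by rw [E.action.p_act, V.src_inv, hf'])
        have k1 := (E.act_congr (M.right_right_inv y f' h).symm rfl
          (by rw [S.vert.q_act, V.tgt_inv, h]) _).trans k
        refine (S.vert_congr k1 rfl _ (by
          rw [S.vert.q_act, ← M.inv_left y f' h]; simp [hf])).trans ?_
        refine (S.vert.act_act _ _ _ (by simp [E.action.p_act])
          (by rw [← M.inv_left y f' h]; simp [hf])).trans ?_
        refine S.vert_congr (E.action.act_act _ _ _ (by simp [hf']) h') ?_ _ _
        refine Eq.trans ?_ (V.inv_comp_rev f (M.left.act y f' h) (by simp [hf])).symm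
        exact V.comp_congr (M.inv_left y f' h).symm rfl _ _
      one_act := fun e =>
        (S.vert_congr (E.action.one_act e) (V.inv_one _) _ (by simp)).trans (S.vert.act_one e) }
  deg e := GroupoidOver.ProdArr.mk (G := V) (K := H.op) (E.deg e) (S.loop e)
    ((E.p_eq e).symm.trans (S.tgt_loop e).symm) ((E.q_eq e).symm.trans (S.src_loop e).symm)
  p_eq := E.p_eq
  q_eq := E.q_eq
  deg_act a e h := by
    obtain ⟨f, y, hf⟩ := a
    have h : H.tgt y = E.p e := h
    have hf : V.tgt f = H.src y := hf
    have ho := S.loop_act_eq_omega y e h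
    have hv : E.p (E.action.act y e h) = V.src (V.inv f) := by
      rw [E.action.p_act, V.src_inv, hf]
    refine GroupoidOver.ProdArr.ext (G := V) (K := H.op) ?_ ?_
    · refine V.comp_left_cancel (f := V.inv f) (by
        rw [← E.p_eq]; exact (S.vert.q_act _ _ _).symm) ?_ ((S.deg_vert _ _ hv).trans ?_)
      · exact (V.tgt_inv f).trans ((V.src_comp _ _ _).trans (V.src_comp _ _ _)).symm
      · exact (V.comp_congr (E.deg_act y e h) (M.left_congr ho rfl _ _) _ (by simp)).trans
          (M.inv_comp_doubleLeft_fst f y _ _ hf _ _ _).symm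
    · exact (S.loop_vert _ _ hv).trans (M.right_congr ho rfl _ _)

end DoubleStructure

end Rep

end MatchedPair

/-! ### The center of a monoidal category -/

namespace CategoryTheory.Center

variable {C : Type*} [Category* C] [MonoidalCategory C]

/-- An isomorphism in the center, from an isomorphism of the underlying objects. -/
def isoOfIso {X Y : Center C} (i : X.1 ≅ Y.1)
    (h : ∀ U, i.hom ▷ U ≫ (Y.2.β U).hom = (X.2.β U).hom ≫ U ◁ i.hom) : X ≅ Y where
  hom := ⟨i.hom, h⟩
  inv := ⟨i.inv, fun U => by
    rw [← cancel_epi (i.hom ▷ U), ← comp_whiskerRight_assoc, i.hom_inv_id, id_whiskerRight,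
      Category.id_comp, reassoc_of% h U, ← MonoidalCategory.whiskerLeft_comp, i.hom_inv_id,
      MonoidalCategory.whiskerLeft_id, Category.comp_id]⟩
  hom_inv_id := Center.ext _ _ i.hom_inv_id
  inv_hom_id := Center.ext _ _ i.inv_hom_id

/-- Equality of objects of the center is detected by a morphism that is an equality of the
underlying objects: commutation with the half-braidings then says that these agree. -/
theorem eqToHom_of_eqToHom {X Y : Center C} (f : X ⟶ Y) (h : X.1 = Y.1) (hf : f.f = eqToHom h) :
    ∃ h' : X = Y, f = eqToHom h' := by
  obtain ⟨X, b⟩ := X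
  obtain ⟨Y, c⟩ := Y
  obtain rfl : X = Y := h
  have hf : f.f = 𝟙 X := hf
  obtain rfl : b = c := by
    obtain ⟨β, _, _⟩ := b
    obtain ⟨γ, _, _⟩ := c
    congr
    funext U
    have := f.comm U
    rw [hf] at this
    ext1
    simpa using this.symm
  exact ⟨rfl, Center.ext _ _ hf⟩

end CategoryTheory.Center

/-! ### The equivalence -/

namespace MatchedPair

variable {P : Type u} {V H : GroupoidOver P} (M : MatchedPair V H)

theorem dRight_inclH (s : M.doubleV.Arr) (y : H.Arr) (h : H.tgt y = V.src (M.fstArr s)) :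
    M.dRight (M.inclH y) s h = M.inclH (M.right.act y (M.fstArr s) h) := by
  refine DiagArr.ext (M := M) ?_ rfl
  refine (M.left_one _ (H.src y) (by simp [inclH])).trans (congrArg V.one ?_)
  refine (congrArg H.src ((M.right_congr rfl (V.inv_one (H.src y)) _ (by simp [inclH])).trans
    (M.right_one _ _ (by simp [inclH])))).trans ?_
  simp [inclH]

theorem dRight_inclV_inv (s : M.doubleV.Arr) (d : V.Arr) (h : V.src d = V.src (M.fstArr s)) :
    M.dRight (M.inclV (V.inv d)) s ((M.tgt_inclV _).trans ((V.tgt_inv d).trans h)) =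
      M.inclV (V.inv (M.left.act (M.sndArr s) d ((M.src_eq s).symm.trans h.symm))) := by
  have hs : H.tgt (M.sndArr s) = V.src d := (M.src_eq s).symm.trans h.symm
  refine DiagArr.ext (M := M) ?_ ?_
  · refine (M.left_congr ?_ rfl _ ((M.tgt_right _ _ _).trans (V.src_inv d).symm)).trans
      (M.inv_left _ d hs).symm
    exact M.right_congr (M.omega_one _ _ _ ((V.tgt_inv d).trans h) _ _) (V.inv_inv d) _ _
  · refine (M.one_right _ _ ((V.tgt_inv d).trans h)).trans (congrArg H.one ?_)
    rw [V.tgt_inv, M.src_left, M.tgt_eq]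

namespace Rep

variable {M}

/-- A morphism `f` of representations of `(V, H)` is compatible with the additional structures on
its source and target. -/
structure DoubleStructure.IsHom {E F : M.Rep} (S : E.DoubleStructure) (T : F.DoubleStructure)
    (f : E ⟶ F) : Prop where
  loop : ∀ e, T.loop (f.toFun e) = S.loop e
  vert : ∀ e d (h : E.p e = V.src d),
    f.toFun (S.vert.act e d h) = T.vert.act (f.toFun e) d ((f.p_toFun e).trans h)

namespace DoubleStructure

variable {E F : M.Rep}

theorem IsHom.comm {S : E.DoubleStructure} {T : F.DoubleStructure} {f : E ⟶ F} (hf : S.IsHom T f)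
    (U : M.Rep) : f ▷ U ≫ (T.halfBraiding.β U).hom = (S.halfBraiding.β U).hom ≫ U ◁ f := by
  apply hom_ext
  rintro ⟨⟨e, u⟩, h⟩
  have h : E.q e = U.p u := h
  have key : U.action.act (H.inv (T.loop (f.toFun e))) u
      (by rw [H.tgt_inv, T.src_loop, f.q_toFun, h]) =
        U.action.act (H.inv (S.loop e)) u (by rw [H.tgt_inv, S.src_loop, h]) :=
    U.act_congr (congrArg H.inv (hf.loop e)) rfl _ _
  apply Subtype.ext
  refine Prod.ext key (Eq.trans ?_ (hf.vert _ _ _).symm)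
  exact T.vert_congr rfl (congrArg U.deg key) _ _

/-- The morphism of representations of the double given by a compatible morphism of
representations. -/
def IsHom.toRepHom {S : E.DoubleStructure} {T : F.DoubleStructure} {f : E ⟶ F}
    (hf : S.IsHom T f) : S.toRep ⟶ T.toRep where
  toFun := f.toFun
  p_toFun := f.p_toFun
  q_toFun := f.q_toFun
  deg_toFun e := GroupoidOver.ProdArr.ext (G := V) (K := H.op) (f.deg_toFun e) (hf.loop e)
  act_toFun _ _ _ := (hf.vert _ _ _).trans (T.vert_congr (f.act_toFun _ _ _) rfl _ _)

theorem loopArr_halfBraiding (S : E.DoubleStructure) (e : E.carrier) :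
    HalfBraiding.loopArr S.halfBraiding e = S.loop e := by
  refine (congrArg H.inv ?_).trans (H.inv_inv _)
  exact H.comp_one_of_eq _ _ (by rw [H.tgt_inv, S.src_loop, V.src_one])

/-- A structure is recovered from its half-braiding. -/
theorem isHom_id_halfBraiding (S : E.DoubleStructure) :
    S.IsHom (HalfBraiding.doubleStructure S.halfBraiding) (𝟙 E) where
  loop e := S.loopArr_halfBraiding e
  vert e d h := by
    have hs : H.tgt (S.loop e) = V.src d := (S.tgt_loop e).trans h
    refine S.vert_congr rfl (Eq.symm ?_) _ _
    refine ((free M _).deg_act _ _ _).trans ?_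
    refine (M.left_congr rfl ((deg_freeGen _).trans
      (M.left_congr (S.loopArr_halfBraiding e) rfl _ hs)) _
        ((H.tgt_inv _).trans (M.src_left _ _ _).symm)).trans ?_
    exact M.inv_left_left _ _ hs

/-- A half-braiding is recovered from its structure. -/
theorem halfBraiding_doubleStructure (b : HalfBraiding E) (U : M.Rep) :
    (HalfBraiding.doubleStructure b).halfBraiding.β U = b.β U := by
  apply Iso.ext
  apply hom_ext
  rintro ⟨⟨e, u⟩, h⟩
  have h : E.q e = U.p u := h
  apply Subtype.ext
  refine Eq.trans ?_ (HalfBraiding.app_eq b U e u h).symm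
  have hu : E.q e = V.src (U.deg u) := h.trans (U.p_eq u)
  refine Prod.ext (U.act_congr (HalfBraiding.arrow_eq b e _ hu).symm rfl _ _) ?_
  refine HalfBraiding.shift_congr b rfl ?_
    ((HalfBraiding.src_loopArr b e).symm.trans (M.src_left _ _ _).symm) hu
  refine (M.left_congr rfl (U.deg_act _ _ _) _ (by rw [M.src_left, H.src_inv]; rfl)).trans ?_
  exact M.left_inv_left _ _ ((HalfBraiding.src_loopArr b e).trans hu)

theorem isHom_doubleStructure (b : HalfBraiding E) (c : HalfBraiding F) (f : E ⟶ F)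
    (h : ∀ U, f ▷ U ≫ (c.β U).hom = (b.β U).hom ≫ U ◁ f) :
    (HalfBraiding.doubleStructure b).IsHom (HalfBraiding.doubleStructure c) f := by
  have key : ∀ (e : E.carrier) (g : V.Arr) (hg : E.q e = V.src g),
      HalfBraiding.arrow c (f.toFun e) g ((f.q_toFun e).trans hg) = HalfBraiding.arrow b e g hg ∧
      HalfBraiding.shift c (f.toFun e) g ((f.q_toFun e).trans hg) =
        f.toFun (HalfBraiding.shift b e g hg) := fun e g hg => by
    have k := congrArg Subtype.val (congr_hom (h (free M g))
      (⟨(e, freeGen M g), hg.trans (p_freeGen g).symm⟩ : (E.tensor (free M g)).carrier))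
    exact ⟨congrArg (fun a => a.1.1) k, congrArg Prod.snd k⟩
  have hl : ∀ e, HalfBraiding.loopArr c (f.toFun e) = HalfBraiding.loopArr b e := fun e =>
    congrArg H.inv ((HalfBraiding.arrow_congr c rfl (congrArg V.one (f.q_toFun e)) _
      (by rw [f.q_toFun, V.src_one])).trans (key e (V.one (E.q e)) (V.src_one _).symm).1)
  refine ⟨hl, fun e d hd => ?_⟩
  have hs := (HalfBraiding.tgt_loopArr b e).trans hd
  refine (key e (M.left.act (HalfBraiding.loopArr b e) d hs)
    (by rw [M.src_left, HalfBraiding.src_loopArr])).2.symm.trans ?_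
  exact HalfBraiding.shift_congr c rfl (M.left_congr (hl e).symm rfl _ _) _
    (by rw [M.src_left, HalfBraiding.src_loopArr])

/-- Restricting the representation of the double given by a structure on `E` gives back `E`. -/
def restrictToRepIso (S : E.DoubleStructure) : restrict S.toRep ≅ E :=
  isoOfInverse
    { toFun := fun e => e
      p_toFun := fun _ => rfl
      q_toFun := fun _ => rfl
      deg_toFun := fun _ => rfl
      act_toFun := fun _ _ _ => (S.vert_congr rfl
        ((V.inv_one _).trans (congrArg V.one (E.action.p_act _ _ _).symm)) _
          (V.src_one _).symm).trans
          (S.vert.act_one _) }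
    (fun e => e) (fun _ => rfl) (fun _ => rfl)

theorem isHom_restrictToRepIso (S : E.DoubleStructure) :
    (restrictStructure S.toRep).IsHom S S.restrictToRepIso.hom where
  loop _ := rfl
  vert e d h := by
    have h : E.p e = V.src d := h
    refine S.vert_congr ?_ (V.inv_inv d) _ _
    refine (E.act_congr (congrArg H.one ((V.tgt_inv d).trans h.symm)) rfl _ (by simp)).trans
      (E.action.one_act e)

end DoubleStructure

/-- A representation of the double is recovered from the structure on the underlying
representation. -/
def toRepRestrictIso (X : M.double.Rep) : X ≅ (restrictStructure X).toRep :=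
  isoOfInverse
    { toFun := fun e => e
      p_toFun := fun _ => rfl
      q_toFun := fun _ => rfl
      deg_toFun := fun _ => rfl
      act_toFun := fun a e h => by
        have ha := DiagArr.comm (M := M) a
        refine (X.act_congr (M.diag_eq a) rfl _ (by
          rw [M.diagonal.tgt_comp]; exact h)).trans ?_
        refine (X.action.act_act _ _ _
          ((M.tgt_inclV _).trans (ha.trans (M.src_inclH _).symm)) h).symm.trans ?_
        exact X.act_congr (congrArg M.inclV (V.inv_inv _).symm) rfl _ _ }
    (fun e => e) (fun _ => rfl) (fun _ => rfl)

/-- The restriction of a morphism of representations of the double. -/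
def restrictMap {X Y : M.double.Rep} (f : X ⟶ Y) : restrict X ⟶ restrict Y where
  toFun := f.toFun
  p_toFun := f.p_toFun
  q_toFun := f.q_toFun
  deg_toFun e := congrArg M.fstArr (f.deg_toFun e)
  act_toFun y e h := f.act_toFun (M.inclH y) e h

theorem isHom_restrictMap {X Y : M.double.Rep} (f : X ⟶ Y) :
    (restrictStructure X).IsHom (restrictStructure Y) (restrictMap f) where
  loop e := congrArg M.sndArr (f.deg_toFun e)
  vert e d _ := f.act_toFun (M.inclV (V.inv d)) e _

variable (M) in
/-- The functor from representations of the double to the center of `Rep(V, H)`. -/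
def toCenter : M.double.Rep ⥤ Center M.Rep where
  obj X := ⟨restrict X, (restrictStructure X).halfBraiding⟩
  map f := ⟨restrictMap f, (isHom_restrictMap f).comm⟩

variable (M) in
/-- The functor from the center of `Rep(V, H)` to representations of the double. -/
def ofCenter : Center M.Rep ⥤ M.double.Rep where
  obj A := (HalfBraiding.doubleStructure A.2).toRep
  map f := (DoubleStructure.isHom_doubleStructure _ _ f.f f.comm).toRepHom

variable (M) in
/-- The equivalence between representations of the double and the center of `Rep(V, H)`. -/
def centerEquiv : M.double.Rep ≌ Center M.Rep where
  functor := toCenter M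
  inverse := ofCenter M
  unitIso := NatIso.ofComponents (fun X => toRepRestrictIso X ≪≫
      isoOfInverse ((restrictStructure X).isHom_id_halfBraiding).toRepHom
        (fun e => e) (fun _ => rfl) (fun _ => rfl))
    (fun _ => rfl)
  counitIso := NatIso.ofComponents (fun A =>
      Center.isoOfIso (X := (toCenter M).obj ((ofCenter M).obj A)) (Y := A)
        (HalfBraiding.doubleStructure A.2).restrictToRepIso (fun U => by
          have := (HalfBraiding.doubleStructure A.2).isHom_restrictToRepIso.comm U
          rwa [DoubleStructure.halfBraiding_doubleStructure] at this))
    (fun _ => rfl)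
  functor_unitIso_comp _ := rfl

/-- The comparison of restriction with tensor products. -/
def restrictTensorIso (X Y : M.double.Rep) :
    (restrict X).tensor (restrict Y) ≅ restrict (X.tensor Y) :=
  isoOfInverse
    { toFun := fun e => e
      p_toFun := fun _ => rfl
      q_toFun := fun _ => rfl
      deg_toFun := fun _ => rfl
      act_toFun := fun y a h => by
        apply Subtype.ext
        refine Prod.ext rfl ?_
        exact Y.act_congr (M.dRight_inclH _ y _).symm rfl _ _ }
    (fun e => e) (fun _ => rfl) (fun _ => rfl)

end Rep

end MatchedPair

/-! ### Monoidality and strictness -/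

namespace MatchedPair.Rep

variable {P : Type u} {V H : GroupoidOver P} {M : MatchedPair V H}

/-- The half-braiding of a tensor product of representations of the double is the one of the tensor
product in the center. -/
theorem restrictTensorIso_comm (X Y : M.double.Rep) (U : M.Rep) :
    (restrictTensorIso X Y).hom ▷ U ≫ ((restrictStructure (X.tensor Y)).halfBraiding.β U).hom =
      ((((toCenter M).obj X ⊗ (toCenter M).obj Y).2.β U).hom) ≫
        U ◁ (restrictTensorIso X Y).hom := by
  apply hom_ext
  rintro ⟨⟨⟨⟨e, f⟩, hef⟩, u⟩, h⟩
  have hef : X.q e = Y.p f := hef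
  have h : Y.q f = U.p u := h
  -- The degree of `(e, f)` has second component `x(f) x(e)`, as `H` occurs in the double with the
  -- opposite composition.
  have hl : H.tgt (M.sndArr (Y.deg f)) = H.src (M.sndArr (X.deg e)) :=
    (((restrictStructure Y).tgt_loop f).trans hef.symm).trans
      ((restrictStructure X).src_loop e).symm
  have hf : H.tgt (H.inv (M.sndArr (Y.deg f))) = U.p u :=
    ((H.tgt_inv _).trans ((restrictStructure Y).src_loop f)).trans h
  have he : H.tgt (H.inv (M.sndArr (X.deg e))) =
      U.p (U.action.act (H.inv (M.sndArr (Y.deg f))) u hf) := by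
    rw [H.tgt_inv, U.action.p_act, H.src_inv, hl]
  have key : U.action.act (H.inv (H.comp (M.sndArr (Y.deg f)) (M.sndArr (X.deg e)) hl)) u
      (by rw [H.inv_comp_rev, H.tgt_comp, hf]) =
        U.action.act (H.inv (M.sndArr (X.deg e)))
          (U.action.act (H.inv (M.sndArr (Y.deg f))) u hf) he :=
    (U.act_congr (H.inv_comp_rev _ _ hl) rfl _ (by rw [H.tgt_comp, hf])).trans
      (U.action.act_act _ _ _ _ hf).symm
  have hd : V.src (U.deg (U.action.act (H.inv (M.sndArr (X.deg e)))
      (U.action.act (H.inv (M.sndArr (Y.deg f))) u hf) he)) = V.src (M.fstArr (X.deg e)) := by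
    rw [← U.p_eq, U.action.p_act, H.src_inv, M.src_eq]
  apply Subtype.ext
  refine Prod.ext key (Subtype.ext (Prod.ext ?_ ?_))
  · exact (restrictStructure X).vert_congr rfl (congrArg U.deg key)
      (by rw [key]; exact (X.p_eq e).trans hd.symm) ((X.p_eq e).trans hd.symm)
  · refine Y.act_congr (Eq.trans (M.double.right_congr (congrArg (fun v => M.inclV (V.inv (U.deg v)))
      key) rfl _ ?_) ((M.dRight_inclV_inv _ _ hd).trans
        (congrArg (fun d => M.inclV (V.inv d)) ?_))) rfl _ _
    · exact (M.tgt_inclV _).trans ((V.tgt_inv _).trans hd)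
    · refine (M.left_congr rfl (U.deg_act _ _ _) _ (by simp)).trans ?_
      exact M.left_inv_left _ _ (by
        rw [← U.p_eq, U.action.p_act, H.src_inv, hl])

variable (M) in
/-- The comparison of restriction with the unit. -/
def restrictUnitIso : unit M ≅ restrict (unit M.double) :=
  isoOfInverse
    { toFun := fun e => e
      p_toFun := fun _ => rfl
      q_toFun := fun _ => rfl
      deg_toFun := fun _ => rfl
      act_toFun := fun y _ _ => (M.src_inclH y).symm }
    (fun e => e) (fun _ => rfl) (fun _ => rfl)

/-- The half-braiding of the unit of the double is the one of the unit of the center. -/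
theorem restrictUnitIso_comm (U : M.Rep) :
    (restrictUnitIso M).hom ▷ U ≫ ((restrictStructure (unit M.double)).halfBraiding.β U).hom =
      ((𝟙_ (Center M.Rep)).2.β U).hom ≫ U ◁ (restrictUnitIso M).hom := by
  apply hom_ext
  rintro ⟨⟨a, u⟩, h⟩
  obtain rfl : a = U.p u := h
  have key : U.action.act (H.inv (H.one (U.p u))) u (by simp) = u :=
    (U.act_congr (H.inv_one _) rfl _ (by simp)).trans (U.action.one_act u)
  apply Subtype.ext
  refine Prod.ext key ?_
  refine (M.src_inclV _).trans ((V.src_inv _).trans ?_)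
  exact (U.q_eq _).symm.trans (congrArg U.q key)

noncomputable instance : (toCenter M).Monoidal :=
  Functor.CoreMonoidal.toMonoidal
    { εIso := Center.isoOfIso (X := 𝟙_ (Center M.Rep)) (Y := (toCenter M).obj (𝟙_ M.double.Rep))
        (restrictUnitIso M) restrictUnitIso_comm
      μIso := fun X Y => Center.isoOfIso (X := (toCenter M).obj X ⊗ (toCenter M).obj Y)
        (Y := (toCenter M).obj (X ⊗ Y)) (restrictTensorIso X Y) (restrictTensorIso_comm X Y)
      μIso_hom_natural_left := fun _ _ => rfl
      μIso_hom_natural_right := fun _ _ => rfl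
      associativity := fun _ _ _ => rfl
      left_unitality := fun _ => rfl
      right_unitality := fun _ => rfl }

noncomputable instance : (centerEquiv M).functor.Monoidal := inferInstanceAs (toCenter M).Monoidal

noncomputable instance : (centerEquiv M).inverse.Monoidal := (centerEquiv M).inverseMonoidal

/-- A morphism of representations that is the identity on elements is an equality of objects. -/
theorem eqToHom_of_id {X Y : M.Rep} (f : X ⟶ Y) (hc : X.carrier = Y.carrier)
    (h : ∀ e, f.toFun e = cast hc e) : ∃ h' : X = Y, f = eqToHom h' := by
  obtain ⟨⟨C, p, q⟩, a, d, hp, hq, hd⟩ := X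
  obtain ⟨⟨C', p', q'⟩, a', d', hp', hq', hd'⟩ := Y
  obtain rfl : C = C' := hc
  obtain rfl : p' = p := by
    funext e
    exact (congrArg p' (h e)).symm.trans (f.p_toFun e)
  obtain rfl : q' = q := by
    funext e
    exact (congrArg q' (h e)).symm.trans (f.q_toFun e)
  obtain rfl : d' = d := by
    funext e
    exact (congrArg d' (h e)).symm.trans (f.deg_toFun e)
  obtain rfl : a' = a := by
    ext y e he
    have h1 : ∀ e' (h' : e' = e) (he' : H.tgt y = p' e'), a'.act y e' he' = a'.act y e he := by
      rintro _ rfl _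
      rfl
    exact (h1 _ (h e) _).symm.trans ((f.act_toFun y e he).symm.trans (h _))
  exact ⟨rfl, hom_ext h⟩

theorem isStrictMonoidal_toCenter : IsStrictMonoidal (centerEquiv M).functor where
  unit_eq := by
    obtain ⟨h, e⟩ := eqToHom_of_id (restrictUnitIso M).hom rfl (fun _ => rfl)
    exact Center.eqToHom_of_eqToHom _ h e
  tensor_eq X Y := by
    obtain ⟨h, e⟩ := eqToHom_of_id (restrictTensorIso X Y).hom rfl (fun _ => rfl)
    exact Center.eqToHom_of_eqToHom _ h e

theorem isStrictMonoidal_ofCenter : IsStrictMonoidal (centerEquiv M).inverse where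
  unit_eq := eqToHom_of_id _ rfl (fun _ => rfl)
  tensor_eq _ _ := eqToHom_of_id _ rfl (fun _ => rfl)

end MatchedPair.Rep

/-- The category of representations of the double of a matched pair of groupoids is strictly
monoidally equivalent to the center of the category of representations of the matched pair, over
the category of quivers. -/
theorem corollary3 {P : Type u} {V H : GroupoidOver P} (M : MatchedPair V H) :
    ∃ (e : M.double.Rep ≌ Center M.Rep) (_ : e.functor.Monoidal) (_ : e.inverse.Monoidal),
      e.IsMonoidal ∧ IsStrictMonoidal e.functor ∧ IsStrictMonoidal e.inverse ∧
        e.functor ⋙ Center.forget M.Rep ⋙ MatchedPair.Rep.forget M =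
          MatchedPair.Rep.forget M.double :=
  -- The monoidal structure of the inverse is defined by the two equations of `e.IsMonoidal`.
  ⟨MatchedPair.Rep.centerEquiv M, inferInstance, inferInstance, ⟨rfl, fun _ _ => rfl⟩,
    MatchedPair.Rep.isStrictMonoidal_toCenter, MatchedPair.Rep.isStrictMonoidal_ofCenter, rfl⟩
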